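/- Let $n\ge 1$ and let $G$ be a connected (finite-dimensional, real) Lie group on which $A=\mathbb{Z}/n\mathbb{Z}$ acts by smooth automorphisms. Let $G^A$ be the subgroup of invariants, $G^A_0$ its identity component, and let $T$ be a maximal compact torus of $G^A_0$, that is, a subgroup isomorphic to a torus $(S^1)^k$ for some $k\ge 0$ which is not properly contained in another such subgroup of $G^A_0$. Let $A$ act on the homogeneous space $G/T$ by $a(gT)=a(g)T$, let $H^0(A,G/T)\subset G/T$ be the set of $A$-fixed points with the subspace topology, let $H^1(A,T)$ be the set of maps $c:A\to T$ with $c(ab)=c(a)\,a(c(b))$ for all $a,b\in A$, modulo the relation $c\sim c'$ if there is $t\in T$ with $c'(a)=t^{-1}c(a)\,a(t)$ for all $a\in A$, and let $\delta:H^0(A,G/T)\to H^1(A,T)$ be the coboundary operator, which sends $gT$ to the class of the cocycle $a\mapsto g^{-1}a(g)$. Then every connected component $M$ of $H^0(A,G/T)$ is a closed homogeneous submanifold of $G/T$ (that is, $M$ is a closed subset and an embedded smooth submanifold of $G/T$, and it is an orbit of a closed subgroup of $G$ acting on $G/T$ by left translations), and the restriction of $\delta$ to $M$ is constant. -/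

import Mathlib

open scoped Manifold ContDiff Topology

noncomputable section

/-! ## Nonabelian cohomology in degrees zero and one -/

namespace NonabelianCohomology

/-- The zeroth nonabelian cohomology of a group `A` with coefficients in an `A`-set `X`:
the set of `A`-invariant elements. -/
abbrev H0 (A X : Type*) [Group A] [MulAction A X] : Set X := MulAction.fixedPoints A X

/-- `1`-cocycles of `A` with values in a (nonabelian) `A`-module `G`. -/
def Z1 (A G : Type*) [Group A] [Group G] [MulDistribMulAction A G] : Type _ :=
  {c : A → G // ∀ a b : A, c (a * b) = c a * a • c b}

/-- The relation of being cohomologous: `c₂ a = g⁻¹ * c₁ a * a(g)` for some `g` and all `a`. -/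
instance cohomologous (A G : Type*) [Group A] [Group G] [MulDistribMulAction A G] :
    Setoid (Z1 A G) where
  r c₁ c₂ := ∃ g : G, ∀ a : A, c₂.1 a = g⁻¹ * c₁.1 a * a • g
  iseqv := by
    refine ⟨fun c => ⟨1, fun a => by simp⟩, ?_, ?_⟩
    · rintro c₁ c₂ ⟨g, hg⟩
      exact ⟨g⁻¹, fun a => by rw [hg a, smul_inv']; group⟩
    · rintro c₁ c₂ c₃ ⟨g, hg⟩ ⟨h, hh⟩
      exact ⟨g * h, fun a => by rw [hh a, hg a, smul_mul']; group⟩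

/-- The first nonabelian cohomology of `A` with coefficients in `G`. -/
def H1 (A G : Type*) [Group A] [Group G] [MulDistribMulAction A G] : Type _ :=
  Quotient (cohomologous A G)

/-- A subgroup of an `A`-module `G` that is an `A`-submodule, i.e. is mapped into itself
by every element of `A`. -/
class IsSubmodule (A : Type*) {G : Type*} [Group A] [Group G] [MulDistribMulAction A G]
    (T : Subgroup G) : Prop where
  smul_mem : ∀ (a : A) (t : G), t ∈ T → a • t ∈ T

section

variable {A G : Type*} [Group A] [Group G] [MulDistribMulAction A G]
  (T : Subgroup G) [hT : IsSubmodule A T]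

/-- The action of `A` on a submodule, by restriction. -/
instance IsSubmodule.mulDistribMulAction : MulDistribMulAction A T where
  smul a t := ⟨a • (t : G), hT.smul_mem a t t.2⟩
  one_smul t := Subtype.ext (one_smul A (t : G))
  mul_smul a b t := Subtype.ext (mul_smul a b (t : G))
  smul_mul a s t := Subtype.ext (smul_mul' a (s : G) (t : G))
  smul_one a := Subtype.ext (smul_one a)

/-- The action of `A` on `G` descends to the set of left cosets `G ⧸ T`, as `a(gT) = a(g)T`. -/
instance IsSubmodule.quotientAction : MulAction.QuotientAction A T where
  inv_mul_mem a g g' h := by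
    rw [← smul_inv', ← smul_mul']
    exact hT.smul_mem a _ h

/-- If the coset `gT` is `A`-invariant, then `a ↦ g⁻¹ * a(g)` is a cocycle with values in `T`. -/
def coboundaryCocycle (g : G) (hg : (g : G ⧸ T) ∈ H0 A (G ⧸ T)) : Z1 A T :=
  ⟨fun a => ⟨g⁻¹ * a • g, QuotientGroup.eq.mp (hg a).symm⟩, fun a b => Subtype.ext (by
    change g⁻¹ * (a * b) • g = g⁻¹ * a • g * a • (g⁻¹ * b • g)
    rw [smul_mul', smul_inv', mul_smul]
    group)⟩

/-- The coboundary operator `δ : H⁰(A, G/T) → H¹(A, T)`, which maps `gT` to the class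
of the cocycle `a ↦ g⁻¹ * a(g)`. -/
def coboundary (x : H0 A (G ⧸ T)) : H1 A T :=
  Quotient.mk _ (coboundaryCocycle T (x : G ⧸ T).out
    (by rw [QuotientGroup.out_eq']; exact x.2))

/-- The value of `δ` does not depend on the chosen representative of the coset. -/
theorem coboundary_mk (g : G) (hg : (g : G ⧸ T) ∈ H0 A (G ⧸ T)) :
    coboundary T ⟨(g : G ⧸ T), hg⟩ = Quotient.mk _ (coboundaryCocycle T g hg) := by
  apply Quotient.sound
  refine ⟨⟨((g : G ⧸ T).out)⁻¹ * g, QuotientGroup.eq.mp (by simp)⟩, fun a => Subtype.ext ?_⟩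
  change g⁻¹ * a • g = (((g : G ⧸ T).out)⁻¹ * g)⁻¹ * (((g : G ⧸ T).out)⁻¹ * a • (g : G ⧸ T).out)
    * a • (((g : G ⧸ T).out)⁻¹ * g)
  rw [smul_mul', smul_inv']
  group

end

end NonabelianCohomology

/-! ## Compact tori -/

/-- The identity component `G₀ᴬ` of the group of invariants `Gᴬ`, as a subgroup of `G`. -/
def invariantsIdentityComponent (A G : Type*) [Group A] [Group G] [TopologicalSpace G]
    [IsTopologicalGroup G] [MulDistribMulAction A G] : Subgroup G :=
  (Subgroup.connectedComponentOfOne (FixedPoints.subgroup A G)).map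
    (FixedPoints.subgroup A G).subtype

/-- A subgroup is a compact torus if it is isomorphic, as a topological group, to a finite power
of the circle group. -/
def IsCompactTorus {G : Type*} [Group G] [TopologicalSpace G] (S : Subgroup G) : Prop :=
  ∃ k : ℕ, Nonempty (S ≃ₜ* (Fin k → Circle))

/-- `T` is a maximal compact torus of the subgroup `H`. -/
def IsMaximalCompactTorus {G : Type*} [Group G] [TopologicalSpace G] (H T : Subgroup G) : Prop :=
  Maximal (fun S : Subgroup G => S ≤ H ∧ IsCompactTorus S) T

/-- A maximal compact torus of `G₀ᴬ` consists of invariants, hence is an `A`-submodule. -/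
theorem IsMaximalCompactTorus.isSubmodule {A G : Type*} [Group A] [Group G] [TopologicalSpace G]
    [IsTopologicalGroup G] [MulDistribMulAction A G] {T : Subgroup G}
    (hT : IsMaximalCompactTorus (invariantsIdentityComponent A G) T) :
    NonabelianCohomology.IsSubmodule A T where
  smul_mem a t ht := by
    obtain ⟨s, -, rfl⟩ := hT.prop.1 ht
    have h : a • (s : G) = s := s.2 a
    exact (congrArg (· ∈ T) h).mpr ht

/-! ## The smooth structure of `G/T` and its submanifolds -/

namespace HomogeneousSpace

variable {E G : Type*} [NormedAddCommGroup E] [NormedSpace ℝ E] [TopologicalSpace G]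
  [ChartedSpace E G] [Group G] (T : Subgroup G)

/-- `φ` is a smooth chart of the homogeneous space `G/T`, for the smooth structure for which the
projection `π : G → G/T` is a submersion. That `φ` is smooth means that `φ ∘ π` is smooth; that
the inverse of `φ` is smooth means that locally it lifts to a smooth map into `G`. -/
structure IsSmoothChart {F : Type*} [NormedAddCommGroup F] [NormedSpace ℝ F]
    (φ : OpenPartialHomeomorph (G ⧸ T) F) : Prop where
  contMDiffOn_comp_mk : ContMDiffOn 𝓘(ℝ, E) 𝓘(ℝ, F) ∞ (fun g : G => φ (g : G ⧸ T))
    ((fun g : G => (g : G ⧸ T)) ⁻¹' φ.source)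
  exists_smooth_lift : ∀ y ∈ φ.target, ∃ U ∈ 𝓝 y, ∃ s : F → G,
    ContMDiffOn 𝓘(ℝ, F) 𝓘(ℝ, E) ∞ s U ∧ ∀ z ∈ U, ((s z : G) : G ⧸ T) = φ.symm z

/-- `M` is a closed (embedded) submanifold of `G/T`: it is a closed subset, and around each of its
points there is a smooth chart of `G/T` with values in `ℝᵖ × ℝ^q` in which `M` is `ℝᵖ × {0}`. -/
def IsClosedSubmanifold (M : Set (G ⧸ T)) : Prop :=
  IsClosed M ∧ ∃ p q : ℕ, ∀ x ∈ M,
    ∃ φ : OpenPartialHomeomorph (G ⧸ T) (EuclideanSpace ℝ (Fin p) × EuclideanSpace ℝ (Fin q)),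
      x ∈ φ.source ∧ IsSmoothChart (E := E) T φ ∧ ∀ y ∈ φ.source, y ∈ M ↔ (φ y).2 = 0

/-- `M` is a closed homogeneous submanifold of `G/T`: a closed submanifold that is an orbit of
a closed subgroup of `G`, acting on `G/T` by left translations. -/
def IsClosedHomogeneousSubmanifold (M : Set (G ⧸ T)) : Prop :=
  IsClosedSubmanifold (E := E) T M ∧
    ∃ L : Subgroup G, IsClosed (L : Set G) ∧ ∃ x : G ⧸ T, M = {y | ∃ l ∈ L, y = l • x}

end HomogeneousSpace

end

/-! Write `H` for the identity component of the group of invariants. The core of the argument is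
that the connected components of `H0 A (G ⧸ T)` are exactly the orbits of `H`. Since `T` is fixed
pointwise, for an invariant coset `gT` the map `a ↦ g⁻¹ a(g)` is a homomorphism into `T`, so its
values are killed by the order of `A` (`pow_card_cocycle`). Such torsion elements are discrete in a
torus (`IsCompactTorus.exists_nhds_torsion`). Hence for `h` near `g` with `hT` invariant, the two
cocycles coincide, which says that `h g⁻¹` is invariant. Being close to one, it lies in `H`
(`mul_inv_mem_of_near`). So `H`-orbits are open in the fixed set; they are connected because `H` is,
hence they are the components (`image_connectedComponent_H0`). The cocycles of `g` and `l g` agree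
literally for invariant `l`, so `δ` is constant on each orbit.

For the manifold structure, averaging gives a chart of `G` at one in which the invariants form a
linear subspace `V` (`exists_linearizing_chart`). If `gT` is invariant, then `g T g⁻¹` consists of
invariants, because `T` is commutative. In this chart it is therefore a submanifold inside `V`, and
a linear complement to its tangent space, chosen compatibly with `V`, is a slice that becomes a
chart of `G/T` at `gT` with the orbit as a coordinate subspace (`exists_slice_chart`).

The torus is given only as a topological group, so its parametrisation is a priori merely
continuous. Its smoothness and immersivity come from `localHom_smooth`: a continuous local
homomorphism is Lipschitz by an averaging estimate, differentiable somewhere by Rademacher, and then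
smooth everywhere nearby by translation and bootstrapping. -/

/-! ## Local analysis in normed spaces -/

/-- The inverse function theorem for smooth maps, with smoothness on the whole source and target. -/
theorem exists_smooth_openPartialHomeomorph {E F : Type*} [NormedAddCommGroup E] [NormedSpace ℝ E]
    [CompleteSpace E] [NormedAddCommGroup F] [NormedSpace ℝ F] {f : E → F} {x₀ : E}
    (f' : E ≃L[ℝ] F) (hf : ∀ᶠ x in 𝓝 x₀, ContDiffAt ℝ ∞ f x)
    (hf' : HasFDerivAt f (f' : E →L[ℝ] F) x₀) :
    ∃ φ : OpenPartialHomeomorph E F, x₀ ∈ φ.source ∧ (∀ x, φ x = f x) ∧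
      (∀ x ∈ φ.source, ContDiffAt ℝ ∞ f x) ∧ ∀ y ∈ φ.target, ContDiffAt ℝ ∞ φ.symm y := by
  have h0 : ContDiffAt ℝ ∞ f x₀ := hf.self_of_nhds
  let φ₀ := h0.toOpenPartialHomeomorph f hf' (by simp)
  have hφ₀ : ∀ x, φ₀ x = f x := fun x => rfl
  -- Invertibility of the derivative is an open condition; shrinking the source to such points makes
  -- the inverse smooth on the whole target, not only at `f x₀`.
  have hinv : ∀ᶠ x in 𝓝 x₀, fderiv ℝ f x ∈ Set.range ((↑) : (E ≃L[ℝ] F) → E →L[ℝ] F) := by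
    have hc : ContinuousAt (fderiv ℝ f) x₀ :=
      (h0.fderiv_right (m := 0) (by simp)).continuousAt
    refine hc ?_
    rw [hf'.fderiv]
    exact f'.nhds
  obtain ⟨S, hS, hSo, hxS⟩ := eventually_nhds_iff.mp (hf.and hinv)
  let φ := φ₀.restrOpen S hSo
  have hsrc : φ.source = φ₀.source ∩ S := φ₀.restrOpen_source S hSo
  refine ⟨φ, ?_, hφ₀, ?_, ?_⟩
  · rw [hsrc]
    exact ⟨h0.mem_toOpenPartialHomeomorph_source hf' (by simp), hxS⟩
  · intro x hx
    rw [hsrc] at hx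
    exact (hS x hx.2).1
  · intro y hy
    have hx : φ.symm y ∈ φ.source := φ.map_target hy
    rw [hsrc] at hx
    obtain ⟨hs, e, he⟩ := hS _ hx.2
    refine φ.contDiffAt_symm (f₀' := e) hy ?_ hs
    rw [he]
    exact (hs.differentiableAt (by simp)).hasFDerivAt

/-! ### Automatic smoothness of continuous local homomorphisms -/

section LocalGroup

variable {V E : Type*} [NormedAddCommGroup V] [NormedSpace ℝ V]
  [NormedAddCommGroup E] [NormedSpace ℝ E]

/-- A continuous local homomorphism into a local group with strictly differentiable
multiplication is Lipschitz near zero. -/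
theorem localHom_lipschitz [CompleteSpace E] {m : E × E → E} {y : V → E} {D : E × E →L[ℝ] E}
    (hm : HasStrictFDerivAt m D (0, 0)) (hD : ∀ x, D (x, 0) = x)
    (hy0 : y 0 = 0) (hy : ∀ᶠ u in 𝓝 (0 : V), ContinuousAt y u)
    (hadd : ∀ᶠ p in 𝓝 ((0 : V), (0 : V)), y (p.1 + p.2) = m (y p.1, y p.2)) :
    ∃ K : NNReal, ∃ ε > 0, LipschitzOnWith K y (Metric.ball 0 ε) := by
  have h1 := (hm.isLittleO.def (c := 1 / 2) (by norm_num))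
  rw [nhds_prod_eq (x := ((0 : E), (0 : E))), nhds_prod_eq] at h1
  -- With the second argument frozen, `m` is the identity up to a relative error `1/2`; strict
  -- differentiability makes this uniform in `z`. The half is absorbed in the final inequality.
  obtain ⟨r, hr, hmr⟩ : ∃ r > 0, ∀ x x' z : E, ‖x‖ < r → ‖x'‖ < r → ‖z‖ < r →
      ‖m (x, z) - m (x', z) - (x - x')‖ ≤ 1 / 2 * ‖x - x'‖ := by
    rw [← nhds_prod_eq, ← nhds_prod_eq] at h1
    obtain ⟨r, hr, h⟩ := Metric.eventually_nhds_iff.mp h1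
    refine ⟨r, hr, fun x x' z hx hx' hz => ?_⟩
    have := h (y := ((x, z), (x', z))) (by simp [Prod.dist_eq, hx, hx', hz])
    simpa [hD, Prod.norm_def] using this
  have hys : ∀ᶠ u in 𝓝 (0 : V), ‖y u‖ < r := by
    have : ContinuousAt (fun u => ‖y u‖) 0 := hy.self_of_nhds.norm
    exact this.eventually_lt continuousAt_const (by simpa [hy0] using hr)
  obtain ⟨ε₁, hε₁, h₁⟩ := Metric.eventually_nhds_iff.mp (hy.and hys)
  obtain ⟨ε₂, hε₂, h₂⟩ := Metric.eventually_nhds_iff.mp hadd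
  -- The points `u + τ • v` used below satisfy `‖u‖ < ε` and `τ ≤ ε + δ < 3ε`, so they stay inside
  -- the ball of radius `5ε`.
  obtain ⟨ε, hε, hεl₁, hεl₂⟩ : ∃ ε > 0, 5 * ε ≤ ε₁ ∧ 5 * ε ≤ ε₂ :=
    ⟨min ε₁ ε₂ / 5, by positivity, by linarith [min_le_left ε₁ ε₂],
      by linarith [min_le_right ε₁ ε₂]⟩
  have hc : ∀ u : V, ‖u‖ < 5 * ε → ContinuousAt y u := fun u hu =>
    (h₁ (by simpa using hu.trans_le hεl₁)).1
  have hb : ∀ u : V, ‖u‖ < 5 * ε → ‖y u‖ < r := fun u hu =>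
    (h₁ (by simpa using hu.trans_le hεl₁)).2
  have ha : ∀ u t : V, ‖u‖ < 5 * ε → ‖t‖ < 5 * ε → y (u + t) = m (y u, y t) := fun u t hu ht =>
    h₂ (y := (u, t)) (by simp [Prod.dist_eq, hu.trans_le hεl₂, ht.trans_le hεl₂])
  refine ⟨⟨4 * r / ε, by positivity⟩, ε, hε, LipschitzOnWith.of_dist_le_mul fun u' hu' u hu => ?_⟩
  rw [mem_ball_zero_iff] at hu hu'
  rw [dist_eq_norm, dist_eq_norm]
  change _ ≤ 4 * r / ε * _
  rcases eq_or_ne u' u with rfl | hne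
  · simp
  set δ := ‖u' - u‖ with hδ
  have hδ0 : 0 < δ := norm_pos_iff.mpr (sub_ne_zero.mpr hne)
  have hδ2 : δ < 2 * ε := (norm_sub_le _ _).trans_lt (by linarith)
  set v : V := δ⁻¹ • (u' - u) with hv
  have hv1 : ‖v‖ = 1 := by
    rw [hv, norm_smul, norm_inv, norm_norm, ← hδ, inv_mul_cancel₀ hδ0.ne']
  have huv : u + δ • v = u' := by
    rw [hv, smul_smul, mul_inv_cancel₀ hδ0.ne', one_smul]; abel
  have hsm : ∀ τ : ℝ, 0 ≤ τ → ‖τ • v‖ = τ := fun τ hτ => by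
    rw [norm_smul, hv1, mul_one, Real.norm_of_nonneg hτ]
  -- Each difference `F (t + δ) - F t` is within half of `‖y u' - y u‖` of `y u' - y u`. Integrated
  -- over `[0, ε]`, the differences telescope to two integrals over intervals of length `δ`, of
  -- total norm at most `2 r δ`. Hence `ε ‖y u' - y u‖ / 2 ≤ 2 r δ`, which gives the constant `4 r /
  -- ε`.
  let F : ℝ → E := fun τ => y (u + τ • v)
  have hFn : ∀ τ, 0 ≤ τ → τ ≤ ε + δ → ‖u + τ • v‖ < 5 * ε := fun τ h0 h1 =>
    (norm_add_le _ _).trans_lt (by rw [hsm τ h0]; linarith)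
  have hFc : ContinuousOn F (Set.Icc 0 (ε + δ)) := fun τ hτ => by
    have h : ContinuousAt y (u + τ • v) := hc _ (hFn τ hτ.1 hτ.2)
    exact (ContinuousAt.comp (f := fun τ : ℝ => u + τ • v) h (by fun_prop)).continuousWithinAt
  have hFi : ∀ a b, 0 ≤ a → a ≤ b → b ≤ ε + δ → IntervalIntegrable F MeasureTheory.volume a b :=
    fun a b h0 hab h1 => (hFc.mono (by
      rw [Set.uIcc_of_le hab]; exact Set.Icc_subset_Icc h0 h1)).intervalIntegrable
  have hFδi : IntervalIntegrable (fun t => F (t + δ)) MeasureTheory.volume 0 ε := by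
    refine ContinuousOn.intervalIntegrable (hFc.comp (by fun_prop) fun t ht => ?_)
    rw [Set.uIcc_of_le hε.le] at ht
    exact ⟨by linarith [ht.1], by linarith [ht.2]⟩
  have key : ‖∫ t in (0 : ℝ)..ε, (F (t + δ) - F t - (y u' - y u))‖ ≤
      1 / 2 * ‖y u' - y u‖ * |ε - 0| := by
    refine intervalIntegral.norm_integral_le_of_norm_le_const fun t ht => ?_
    rw [Set.uIoc_of_le hε.le] at ht
    have e1 : F (t + δ) = m (y u', y (t • v)) := by
      rw [← ha u' _ (by linarith) (by rw [hsm t ht.1.le]; linarith [ht.2]), ← huv]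
      simp only [F, add_smul]
      congr 1; abel
    have e2 : F t = m (y u, y (t • v)) :=
      ha u _ (by linarith) (by rw [hsm t ht.1.le]; linarith [ht.2])
    rw [e1, e2]
    exact hmr _ _ _ (hb _ (by linarith)) (hb _ (by linarith))
      (hb _ (by rw [hsm t ht.1.le]; linarith [ht.2]))
  have e3 : ∫ t in (0 : ℝ)..ε, (F (t + δ) - F t - (y u' - y u)) =
      (∫ t in ε..(ε + δ), F t) - (∫ t in (0 : ℝ)..δ, F t) - ε • (y u' - y u) := by
    rw [intervalIntegral.integral_sub (hFδi.sub (hFi 0 ε le_rfl hε.le (by linarith)))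
      intervalIntegrable_const, intervalIntegral.integral_sub hFδi
      (hFi 0 ε le_rfl hε.le (by linarith)), intervalIntegral.integral_const,
      intervalIntegral.integral_comp_add_right, sub_zero, zero_add]
    congr 1
    have := (intervalIntegral.integral_add_adjacent_intervals
      (hFi 0 δ le_rfl hδ0.le (by linarith)) (hFi δ (ε + δ) hδ0.le (by linarith) le_rfl)).trans
      (intervalIntegral.integral_add_adjacent_intervals
      (hFi 0 ε le_rfl hε.le (by linarith)) (hFi ε (ε + δ) hε.le (by linarith) le_rfl)).symm
    rw [sub_eq_sub_iff_add_eq_add, add_comm, this, add_comm]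
  have b1 : ‖∫ t in ε..(ε + δ), F t‖ ≤ r * |ε + δ - ε| :=
    intervalIntegral.norm_integral_le_of_norm_le_const fun t ht => by
      rw [Set.uIoc_of_le (by linarith)] at ht
      exact (hb _ (hFn t (by linarith [ht.1]) ht.2)).le
  have b2 : ‖∫ t in (0 : ℝ)..δ, F t‖ ≤ r * |δ - 0| :=
    intervalIntegral.norm_integral_le_of_norm_le_const fun t ht => by
      rw [Set.uIoc_of_le hδ0.le] at ht
      exact (hb _ (hFn t ht.1.le (by linarith [ht.2]))).le
  rw [add_sub_cancel_left, abs_of_pos hδ0] at b1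
  rw [sub_zero, abs_of_pos hδ0] at b2
  rw [e3, sub_zero, abs_of_pos hε] at key
  have b3 : ε * ‖y u' - y u‖ ≤ 1 / 2 * ‖y u' - y u‖ * ε + (r * δ + r * δ) := by
    rw [← Real.norm_of_nonneg hε.le, ← norm_smul, Real.norm_of_nonneg hε.le]
    set I := (∫ t in ε..(ε + δ), F t)
    set J := (∫ t in (0 : ℝ)..δ, F t)
    calc ‖ε • (y u' - y u)‖ = ‖(I - J) - (I - J - ε • (y u' - y u))‖ := by congr 1; abel
      _ ≤ ‖I - J‖ + ‖I - J - ε • (y u' - y u)‖ := norm_sub_le _ _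
      _ ≤ _ := by linarith [norm_sub_le I J]
  rw [div_mul_eq_mul_div, le_div_iff₀ hε]
  nlinarith

/-- A continuous local homomorphism from a finite-dimensional vector space into a smooth local
group is smooth near zero, and its derivative at zero only kills directions along which it is
constant. -/
theorem localHom_smooth [FiniteDimensional ℝ V] [FiniteDimensional ℝ E]
    {m : E × E → E} {y : V → E}
    (hm : ∀ᶠ p in 𝓝 ((0 : E), (0 : E)), ContDiffAt ℝ ∞ m p)
    (hm1 : ∀ᶠ x in 𝓝 (0 : E), m (x, 0) = x)
    (hy0 : y 0 = 0) (hy : ∀ᶠ u in 𝓝 (0 : V), ContinuousAt y u)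
    (hadd : ∀ᶠ p in 𝓝 ((0 : V), (0 : V)), y (p.1 + p.2) = m (y p.1, y p.2)) :
    (∀ᶠ u in 𝓝 (0 : V), ContDiffAt ℝ ∞ y u) ∧
      ∀ v, fderiv ℝ y 0 v = 0 → ∀ᶠ t in 𝓝 (0 : ℝ), y (t • v) = 0 := by
  have hms : HasStrictFDerivAt m (fderiv ℝ m (0, 0)) (0, 0) :=
    hm.self_of_nhds.hasStrictFDerivAt (by simp)
  have hD : ∀ x, fderiv ℝ m (0, 0) (x, 0) = x := by
    intro x
    have h1 : HasFDerivAt (fun x : E => m (x, 0))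
        ((fderiv ℝ m (0, 0)).comp (ContinuousLinearMap.inl ℝ E E)) 0 :=
      HasFDerivAt.comp (f := fun x : E => (x, (0 : E))) (0 : E) hms.hasFDerivAt (hasFDerivAt_prodMk_left (𝕜 := ℝ) (0 : E) (0 : E))
    have h2 : HasFDerivAt (fun x : E => m (x, 0)) (ContinuousLinearMap.id ℝ E) 0 :=
      (hasFDerivAt_id (0 : E)).congr_of_eventuallyEq hm1
    exact congrArg (fun L : E →L[ℝ] E => L x) (h1.unique h2)
  obtain ⟨K, ε₀, hε₀, hlip⟩ := localHom_lipschitz hms hD hy0 hy hadd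
  have hyp : ContinuousAt (fun p : V × V => (y p.1, y p.2)) (0, 0) :=
    (hy.self_of_nhds.comp (f := Prod.fst) (x := ((0 : V), (0 : V))) continuousAt_fst).prodMk
      (hy.self_of_nhds.comp (f := Prod.snd) (x := ((0 : V), (0 : V))) continuousAt_snd)
  have hmy : ∀ᶠ p in 𝓝 ((0 : V), (0 : V)), ContDiffAt ℝ ∞ m (y p.1, y p.2) := by
    refine hyp.eventually ?_
    simpa [hy0] using hm
  obtain ⟨ε₁, hε₁, h₁⟩ := Metric.eventually_nhds_iff.mp (hadd.and hmy)
  obtain ⟨ε, hε, hεl₀, hεl₁⟩ : ∃ ε > 0, ε ≤ ε₀ ∧ ε ≤ ε₁ :=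
    ⟨min ε₀ ε₁, by positivity, min_le_left _ _, min_le_right _ _⟩
  have ha : ∀ u t : V, ‖u‖ < ε → ‖t‖ < ε → y (u + t) = m (y u, y t) ∧
      ContDiffAt ℝ ∞ m (y u, y t) := fun u t hu ht =>
    h₁ (y := (u, t)) (by simp [Prod.dist_eq, hu.trans_le hεl₁, ht.trans_le hεl₁])
  -- Near `u + t` one has `y z = m (y u, y (z - u))`, so differentiability is transported from `t`
  -- to `u + t`.
  have htrans : ∀ u t : V, ‖u‖ < ε → ‖t‖ < ε → DifferentiableAt ℝ y t →
      HasFDerivAt y (((fderiv ℝ m (y u, y t)).comp (ContinuousLinearMap.inr ℝ E E)).comp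
        (fderiv ℝ y t)) (u + t) := by
    intro u t hu ht hd
    have h1 : HasFDerivAt m (fderiv ℝ m (y u, y t)) (y u, y t) :=
      ((ha u t hu ht).2.differentiableAt (by simp)).hasFDerivAt
    have h2 : HasFDerivAt (fun z : E => m (y u, z))
        ((fderiv ℝ m (y u, y t)).comp (ContinuousLinearMap.inr ℝ E E)) (y t) :=
      h1.comp (y t) (hasFDerivAt_prodMk_right (𝕜 := ℝ) (y u) (y t))
    have h3 : HasFDerivAt (fun z : V => m (y u, y z)) _ t := h2.comp t hd.hasFDerivAt
    have h4 : HasFDerivAt (fun z : V => m (y u, y (z - u))) (((fderiv ℝ m (y u, y t)).comp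
        (ContinuousLinearMap.inr ℝ E E)).comp (fderiv ℝ y t)) (u + t) := by
      have h5 : HasFDerivAt (fun z : V => m (y u, y z)) (((fderiv ℝ m (y u, y t)).comp
        (ContinuousLinearMap.inr ℝ E E)).comp (fderiv ℝ y t)) ((u + t) - u) := by
        rwa [add_sub_cancel_left]
      simpa [Function.comp_def] using h5.comp (u + t) ((hasFDerivAt_id (u + t)).sub_const u)
    refine h4.congr_of_eventuallyEq ?_
    have : ∀ᶠ z in 𝓝 (u + t), ‖z - u‖ < ε :=
      (continuous_id.sub continuous_const).norm.continuousAt.eventually_lt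
        continuousAt_const (by simpa using ht)
    filter_upwards [this] with z hz
    rw [← (ha u (z - u) hu hz).1, add_sub_cancel]
  -- Rademacher's theorem yields one point of differentiability `u₀`; translation by `-u₀` brings it
  -- to zero.
  have hd0 : DifferentiableAt ℝ y 0 := by
    obtain ⟨u₀, hu₀, hd⟩ : ∃ u₀ : V, ‖u₀‖ < ε ∧ DifferentiableAt ℝ y u₀ := by
      let _ : MeasurableSpace V := borel V
      have _ : BorelSpace V := ⟨rfl⟩
      have hae := (hlip.mono (Metric.ball_subset_ball hεl₀)).ae_differentiableWithinAt_of_mem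
        (μ := MeasureTheory.Measure.addHaar)
      have hpos : MeasureTheory.Measure.addHaar (Metric.ball (0 : V) ε) ≠ 0 :=
        (Metric.measure_ball_pos _ _ hε).ne'
      obtain ⟨u₀, hu₀, h⟩ := (MeasureTheory.frequently_ae_mem_iff.mpr hpos).and_eventually hae
        |>.exists
      exact ⟨u₀, by simpa using hu₀,
        (h hu₀).differentiableAt (Metric.isOpen_ball.mem_nhds hu₀)⟩
    have := htrans (-u₀) u₀ (by simpa using hu₀) hu₀ hd
    rw [neg_add_cancel] at this
    exact this.differentiableAt
  have hder : ∀ u : V, ‖u‖ < ε → HasFDerivAt y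
      (((fderiv ℝ m (y u, 0)).comp (ContinuousLinearMap.inr ℝ E E)).comp (fderiv ℝ y 0)) u := by
    intro u hu
    have := htrans u 0 hu (by simpa using hε) hd0
    rwa [add_zero, hy0] at this
  -- Bootstrapping: `hder` expresses the derivative of `y` at `u` smoothly in terms of `y u`, so
  -- `C^N` implies `C^(N+1)`.
  have hsm : ∀ N : ℕ, ContDiffOn ℝ N y (Metric.ball 0 ε) := by
    intro N
    induction N with
    | zero =>
      exact contDiffOn_zero.mpr fun u hu =>
        (hder u (by simpa using hu)).continuousAt.continuousWithinAt
    | succ N ih =>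
      rw [Nat.cast_succ, contDiffOn_succ_iff_fderiv_of_isOpen Metric.isOpen_ball]
      refine ⟨fun u hu => (hder u (by simpa using hu)).differentiableAt.differentiableWithinAt,
        by simp, ?_⟩
      have : ContDiffOn ℝ N (fun u => ((fderiv ℝ m (y u, 0)).comp
          (ContinuousLinearMap.inr ℝ E E)).comp (fderiv ℝ y 0)) (Metric.ball 0 ε) := by
        refine ContDiffOn.clm_comp (ContDiffOn.clm_comp ?_ contDiffOn_const) contDiffOn_const
        intro u hu
        have hu' : ‖u‖ < ε := by simpa using hu
        have h1 : ContDiffAt ℝ N (fderiv ℝ m) (y u, 0) := by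
          have h2 := (ha u 0 hu' (by simpa using hε)).2
          rw [hy0] at h2
          exact h2.fderiv_right (by exact_mod_cast le_top)
        exact h1.comp_contDiffWithinAt u ((ih u hu).prodMk contDiffWithinAt_const)
      exact this.congr fun u hu => (hder u (by simpa using hu)).fderiv
  refine ⟨?_, fun v hv => ?_⟩
  · filter_upwards [Metric.ball_mem_nhds (0 : V) hε] with u hu
    exact contDiffAt_infty.mpr fun N => (hsm N).contDiffAt (Metric.isOpen_ball.mem_nhds hu)
  · have hc : ∀ᶠ t in 𝓝 (0 : ℝ), ‖t • v‖ < ε :=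
      (continuous_id.smul continuous_const).norm.continuousAt.eventually_lt
        continuousAt_const (by simpa using hε)
    obtain ⟨η, hη, h⟩ := Metric.eventually_nhds_iff.mp hc
    filter_upwards [Metric.ball_mem_nhds (0 : ℝ) hη] with t ht
    have hderiv : ∀ τ ∈ Metric.ball (0 : ℝ) η, HasDerivAt (fun τ : ℝ => y (τ • v)) 0 τ := by
      intro τ hτ
      have h1 := (hder (τ • v) (h hτ)).comp_hasDerivAt τ ((hasDerivAt_id τ).smul_const v)
      have h2 : (((fderiv ℝ m (y (τ • v), 0)).comp (ContinuousLinearMap.inr ℝ E E)).comp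
          (fderiv ℝ y 0)) ((1 : ℝ) • v) = 0 := by
        rw [ContinuousLinearMap.comp_apply, one_smul, hv, map_zero]
      rw [← h2]
      exact h1
    have := (convex_ball (0 : ℝ) η).is_const_of_fderivWithin_eq_zero (𝕜 := ℝ)
      (f := fun τ : ℝ => y (τ • v))
      (fun τ hτ => (hderiv τ hτ).differentiableAt.differentiableWithinAt)
      (fun τ hτ => by
        rw [fderivWithin_of_isOpen Metric.isOpen_ball hτ]
        ext
        simpa using (hderiv τ hτ).deriv)
      (Metric.mem_ball_self hη) ht
    simpa [hy0] using this.symm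

end LocalGroup

/-- Splitting of `E` along a flag `range D ≤ V ≤ E`, with model complements. -/
theorem exists_flag_splitting {E : Type*} [NormedAddCommGroup E] [NormedSpace ℝ E]
    [FiniteDimensional ℝ E] (V : Submodule ℝ E) {k : ℕ} (D : (Fin k → ℝ) →L[ℝ] E)
    (hinj : ∀ u, D u = 0 → u = 0) (hrange : ∀ u, D u ∈ V) :
    ∃ P : (EuclideanSpace ℝ (Fin (Module.finrank ℝ V - k)) ×
        EuclideanSpace ℝ (Fin (Module.finrank ℝ E - Module.finrank ℝ V))) →L[ℝ] E,
      (∀ w, P w ∈ V ↔ w.2 = 0) ∧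
      ∃ e : ((EuclideanSpace ℝ (Fin (Module.finrank ℝ V - k)) ×
        EuclideanSpace ℝ (Fin (Module.finrank ℝ E - Module.finrank ℝ V))) × (Fin k → ℝ)) ≃L[ℝ] E,
        ∀ w u, e (w, u) = P w + D u := by
  have hDi : Function.Injective (D : (Fin k → ℝ) →ₗ[ℝ] E) :=
    (injective_iff_map_eq_zero _).mpr hinj
  let DV : (Fin k → ℝ) →ₗ[ℝ] V := (D : (Fin k → ℝ) →ₗ[ℝ] E).codRestrict V hrange
  have hDV : Function.Injective DV := fun a b h => hDi (congrArg Subtype.val h)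
  obtain ⟨W₁, hW₁⟩ := (LinearMap.range DV).exists_isCompl
  obtain ⟨W₂, hW₂⟩ := V.exists_isCompl
  have hd1 : Module.finrank ℝ (LinearMap.range DV) = k := by
    rw [LinearMap.finrank_range_of_inj hDV, Module.finrank_fin_fun]
  have hs1 := Submodule.finrank_add_eq_of_isCompl hW₁
  have hs2 := Submodule.finrank_add_eq_of_isCompl hW₂
  -- This and the next bound make the truncated subtractions in the dimensions genuine.
  have hkV : k ≤ Module.finrank ℝ V := by omega
  have hVE : Module.finrank ℝ V ≤ Module.finrank ℝ E := V.finrank_le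
  let i₁ : EuclideanSpace ℝ (Fin (Module.finrank ℝ V - k)) ≃ₗ[ℝ] W₁ :=
    LinearEquiv.ofFinrankEq _ _ (by rw [finrank_euclideanSpace_fin]; omega)
  let i₂ : EuclideanSpace ℝ (Fin (Module.finrank ℝ E - Module.finrank ℝ V)) ≃ₗ[ℝ] W₂ :=
    LinearEquiv.ofFinrankEq _ _ (by rw [finrank_euclideanSpace_fin]; omega)
  let P := (V.subtype ∘ₗ W₁.subtype ∘ₗ i₁.toLinearMap).coprod (W₂.subtype ∘ₗ i₂.toLinearMap)
  have hP : ∀ a b, P (a, b) = ((i₁ a : V) : E) + (i₂ b : E) := fun a b => rfl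
  have hPV : ∀ w, P w ∈ V ↔ w.2 = 0 := by
    rintro ⟨a, b⟩
    rw [hP, V.add_mem_iff_right (i₁ a : V).2]
    constructor
    · intro h
      have h0 : (i₂ b : E) = 0 := Submodule.disjoint_def.mp hW₂.disjoint _ h (i₂ b).2
      exact i₂.map_eq_zero_iff.mp (Subtype.ext h0)
    · rintro (rfl : b = 0)
      simp
  let e := P.coprod (D : (Fin k → ℝ) →ₗ[ℝ] E)
  have he : ∀ w u, e (w, u) = P w + D u := fun w u => rfl
  have hei : Function.Injective e := by
    refine (injective_iff_map_eq_zero _).mpr ?_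
    rintro ⟨⟨a, b⟩, u⟩ h
    rw [he] at h
    have hb : b = 0 := (hPV (a, b)).mp (by
      rw [eq_neg_of_add_eq_zero_left h]; exact V.neg_mem (hrange u))
    subst hb
    have h1 : (i₁ a : V) = DV (-u) := Subtype.ext (by
      have : ((i₁ a : V) : E) + D u = 0 := by simpa [hP] using h
      simpa [DV] using eq_neg_of_add_eq_zero_left this)
    have h2 : (i₁ a : V) = 0 := Submodule.disjoint_def.mp hW₁.disjoint _
      (h1 ▸ LinearMap.mem_range_self _ _) (i₁ a).2
    have ha : a = 0 := i₁.map_eq_zero_iff.mp (Subtype.ext h2)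
    have hu : u = 0 := by
      have : DV (-u) = DV 0 := by rw [← h1, h2, map_zero]
      simpa using hDV this
    rw [ha, hu]; rfl
  refine ⟨P.toContinuousLinearMap, hPV,
    (LinearMap.linearEquivOfInjective e hei ?_).toContinuousLinearEquiv, fun w u => rfl⟩
  rw [Module.finrank_prod, Module.finrank_prod, finrank_euclideanSpace_fin,
    finrank_euclideanSpace_fin, Module.finrank_fin_fun]
  omega

/-! ## One-parameter description of compact tori -/

/-- A compact torus is parametrised by a continuous homomorphism from `ℝᵏ` that is locally
injective and whose restrictions to neighbourhoods of zero cover neighbourhoods of one. -/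
theorem IsCompactTorus.exists_param {G : Type*} [Group G] [TopologicalSpace G] {T : Subgroup G}
    (hT : IsCompactTorus T) :
    ∃ (k : ℕ) (s : (Fin k → ℝ) → G), Continuous s ∧ (∀ u v, s (u + v) = s u * s v) ∧
      (∀ u, s u ∈ T) ∧ (∀ᶠ u in 𝓝 0, s u = 1 → u = 0) ∧
      ∀ N ∈ 𝓝 (0 : Fin k → ℝ), ∃ O ∈ 𝓝 (1 : G), ∀ t ∈ T, t ∈ O → ∃ u ∈ N, s u = t := by
  obtain ⟨k, ⟨χ⟩⟩ := hT
  let ex : (Fin k → ℝ) → (Fin k → Circle) := fun u i => Circle.exp (u i)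
  have hexc : Continuous ex := by fun_prop
  refine ⟨k, fun u => (χ.symm (ex u) : G), ?_, ?_, fun u => (χ.symm (ex u)).2, ?_, ?_⟩
  · exact continuous_subtype_val.comp (χ.symm.continuous.comp hexc)
  · intro u v
    have h : ex (u + v) = ex u * ex v := by
      funext i
      simp [ex, Circle.exp_add]
    simp only [h, map_mul, Subgroup.coe_mul]
  -- On the cube `|u i| < π` the only multiple of `2π` is zero.
  · have : ∀ᶠ u in 𝓝 (0 : Fin k → ℝ), ∀ i, u i ∈ Metric.ball (0 : ℝ) Real.pi := by
      refine Filter.eventually_all.mpr fun i => ?_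
      exact (continuous_apply i).continuousAt.eventually_mem
        (Metric.ball_mem_nhds _ Real.pi_pos)
    filter_upwards [this] with u hu h
    have h1 : ex u = 1 := by
      have : χ.symm (ex u) = χ.symm 1 := by rw [map_one]; exact Subtype.ext h
      exact χ.symm.injective this
    ext i
    have h2 : Circle.exp (u i) = 1 := congrFun h1 i
    obtain ⟨j, hj⟩ := Circle.exp_eq_one.mp h2
    have h3 : |u i| < Real.pi := by simpa using hu i
    rw [hj, abs_mul, abs_of_pos (by positivity : 0 < 2 * Real.pi)] at h3
    have h4 : |(j : ℝ)| < 1 := by nlinarith [Real.pi_pos, abs_nonneg (j : ℝ)]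
    have h5 : j = 0 := by
      rw [← Int.abs_lt_one_iff]; exact_mod_cast h4
    rw [hj, h5]; simp
  · intro N hN
    -- The coordinatewise argument is a section of `ex`, continuous at one.
    have hN' : ex '' N ∈ 𝓝 (1 : Fin k → Circle) := by
      have hc : ContinuousAt (fun z : Fin k → Circle => fun i => Complex.arg (z i)) 1 := by
        refine continuousAt_pi.mpr fun i => ?_
        exact ContinuousAt.comp (f := fun z : Fin k → Circle => (z i : ℂ)) (g := Complex.arg)
          (Complex.continuousAt_arg (by simp))
          (Continuous.comp (g := fun z : Circle => (z : ℂ)) continuous_induced_dom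
            (continuous_apply i)).continuousAt
      have : ∀ᶠ z in 𝓝 (1 : Fin k → Circle), (fun i => Complex.arg (z i)) ∈ N :=
        hc (by
          convert! hN using 2
          ext i
          simp)
      filter_upwards [this] with z hz
      exact ⟨_, hz, funext fun i => Circle.exp_arg (z i)⟩
    have h1 : (fun t : T => χ t) ⁻¹' (ex '' N) ∈ 𝓝 (1 : T) :=
      χ.continuous.continuousAt.preimage_mem_nhds (by
        change ex '' N ∈ 𝓝 (χ 1)
        rwa [map_one])
    obtain ⟨O, hO, hsub⟩ := mem_nhds_subtype _ _ _ |>.mp h1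
    refine ⟨O, hO, fun t ht htO => ?_⟩
    obtain ⟨u, hu, he⟩ := hsub (show (⟨t, ht⟩ : T) ∈ _ from htO)
    refine ⟨u, hu, ?_⟩
    change ((χ.symm (ex u) : T) : G) = t
    rw [he, χ.symm_apply_apply]

/-! ## Linearisation of a finite group action near a fixed point -/

/-- Near the identity, the invariants of a finite group of smooth automorphisms are a linear
subspace in a suitable smooth chart. -/
theorem exists_linearizing_chart {E G A : Type*} [NormedAddCommGroup E] [NormedSpace ℝ E]
    [FiniteDimensional ℝ E] [TopologicalSpace G] [ChartedSpace E G] [Group G]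
    [IsManifold 𝓘(ℝ, E) ∞ G] [Group A] [Finite A] [MulDistribMulAction A G]
    (hsmooth : ∀ a : A, ContMDiff 𝓘(ℝ, E) 𝓘(ℝ, E) ∞ (fun g : G => a • g)) :
    ∃ (ψ : OpenPartialHomeomorph G E) (V : Submodule ℝ E), 1 ∈ ψ.source ∧ ψ 1 = 0 ∧
      ContMDiffOn 𝓘(ℝ, E) 𝓘(ℝ, E) ∞ ψ ψ.source ∧
      ContMDiffOn 𝓘(ℝ, E) 𝓘(ℝ, E) ∞ ψ.symm ψ.target ∧
      ∀ h ∈ ψ.source, (∀ a : A, a • h = h) ↔ ψ h ∈ V := by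
  have _ : Fintype A := Fintype.ofFinite A
  let e : OpenPartialHomeomorph G E := chartAt E (1 : G)
  have he1 : (1 : G) ∈ e.source := mem_chart_source E 1
  have hes : ContMDiffOn 𝓘(ℝ, E) 𝓘(ℝ, E) ∞ e e.source := contMDiffOn_chart
  have het : ContMDiffOn 𝓘(ℝ, E) 𝓘(ℝ, E) ∞ e.symm e.target := contMDiffOn_chart_symm
  let x₀ : E := e 1
  have hx₀ : x₀ ∈ e.target := e.map_source he1
  have hex₀ : e.symm x₀ = 1 := e.left_inv he1
  let f : A → E → E := fun a x => e (a • e.symm x)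
  have hfx₀ : ∀ a, f a x₀ = x₀ := fun a => by simp only [f, hex₀, smul_one]; rfl
  have hdom : ∀ a : A, ∀ᶠ x in 𝓝 x₀, x ∈ e.target ∧ a • e.symm x ∈ e.source := fun a => by
    refine Filter.Eventually.and (e.open_target.mem_nhds hx₀) ?_
    have h1 : ContinuousAt (fun x => a • e.symm x) x₀ :=
      ContinuousAt.comp (g := fun g : G => a • g) (hsmooth a).continuous.continuousAt
        (e.continuousAt_symm hx₀)
    exact h1.eventually_mem (e.open_source.mem_nhds (by rw [hex₀, smul_one]; exact he1))
  have hfs : ∀ a, ∀ᶠ x in 𝓝 x₀, ContDiffAt ℝ ∞ (f a) x := fun a => by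
    filter_upwards [hdom a] with x hx
    rw [← contMDiffAt_iff_contDiffAt]
    have h1 : ContMDiffAt 𝓘(ℝ, E) 𝓘(ℝ, E) ∞ (fun x => a • e.symm x) x :=
      (hsmooth a).contMDiffAt.comp x (het.contMDiffAt (e.open_target.mem_nhds hx.1))
    exact (hes.contMDiffAt (e.open_source.mem_nhds hx.2)).comp x h1
  have hfd : ∀ a, HasFDerivAt (f a) (fderiv ℝ (f a) x₀) x₀ := fun a =>
    ((hfs a).self_of_nhds.differentiableAt (by simp)).hasFDerivAt
  have hfmul : ∀ a b, ∀ᶠ x in 𝓝 x₀, f a (f b x) = f (a * b) x := fun a b => by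
    filter_upwards [hdom b] with x hx
    simp only [f]
    rw [e.left_inv hx.2, mul_smul]
  let L : A → E →L[ℝ] E := fun a => fderiv ℝ (f a) x₀
  have hLmul : ∀ a b v, L (a * b) v = L a (L b v) := fun a b v => by
    have h1 : HasFDerivAt (fun x => f a (f b x)) ((L a).comp (L b)) x₀ :=
      HasFDerivAt.comp (g := f a) (g' := L a) x₀ (by rw [hfx₀]; exact hfd a) (hfd b)
    have h2 := (hfd (a * b)).congr_of_eventuallyEq (hfmul a b)
    rw [show L (a * b) = (L a).comp (L b) from h2.unique h1]; rfl
  have hL1 : ∀ v, L 1 v = v := fun v => by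
    have h1 : f 1 =ᶠ[𝓝 x₀] id := by
      filter_upwards [hdom 1] with x hx
      simp only [f, one_smul, id]
      exact e.right_inv hx.1
    have h2 := (hasFDerivAt_id (𝕜 := ℝ) x₀).congr_of_eventuallyEq h1
    rw [show L 1 = ContinuousLinearMap.id ℝ E from (hfd 1).unique h2]; rfl
  have hLinv : ∀ a v, L a⁻¹ (L a v) = v := fun a v => by rw [← hLmul, inv_mul_cancel, hL1]
  -- Bochner's averaging trick: each summand has derivative `(L a)⁻¹ ∘ L a = id` at `x₀`, so `θ` is
  -- a local coordinate change, and the substitution `a ↦ a * b` in the sum shows that it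
  -- intertwines `f b` with the linear map `L b`.
  let θ : E → E := fun x => (Fintype.card A : ℝ)⁻¹ • ∑ a, L a⁻¹ (f a x - x₀)
  have hθ₀ : θ x₀ = 0 := by simp [θ, hfx₀]
  have hθs : ∀ᶠ x in 𝓝 x₀, ContDiffAt ℝ ∞ θ x := by
    filter_upwards [Filter.eventually_all.mpr hfs] with x hx
    refine ContDiffAt.const_smul _ (ContDiffAt.sum fun a _ => ?_)
    exact (L a⁻¹).contDiff.contDiffAt.comp x ((hx a).sub contDiffAt_const)
  have hθd : HasFDerivAt θ ((ContinuousLinearEquiv.refl ℝ E : E ≃L[ℝ] E) : E →L[ℝ] E) x₀ := by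
    have h1 : HasFDerivAt θ ((Fintype.card A : ℝ)⁻¹ • ∑ a, (L a⁻¹).comp (L a)) x₀ := by
      refine HasFDerivAt.const_smul (HasFDerivAt.fun_sum fun a _ => ?_) _
      exact (L a⁻¹).hasFDerivAt.comp x₀ ((hfd a).sub_const x₀)
    convert! h1
    ext v
    simp [hLinv, ← Nat.cast_smul_eq_nsmul ℝ, smul_smul]
  have hθeq : ∀ b, ∀ᶠ x in 𝓝 x₀, θ (f b x) = L b (θ x) := fun b => by
    filter_upwards [Filter.eventually_all.mpr fun a => hfmul a b] with x hx
    simp only [θ, map_smul, map_sum, hx]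
    congr 1
    refine Fintype.sum_equiv (Equiv.mulRight b) _ _ fun a => ?_
    rw [← hLmul]
    simp
  obtain ⟨φ, hφ₀, hφ, hφs, hφt⟩ := exists_smooth_openPartialHomeomorph _ hθs hθd
  let ψ₀ := e.trans φ
  have hψ₀1 : (1 : G) ∈ ψ₀.source := by
    rw [OpenPartialHomeomorph.trans_source]; exact ⟨he1, hφ₀⟩
  have hev : ∀ᶠ h in 𝓝 (1 : G), ∀ a : A, a • h ∈ ψ₀.source ∧ θ (f a (e h)) = L a (θ (e h)) := by
    refine Filter.eventually_all.mpr fun a => Filter.Eventually.and ?_ ?_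
    · exact (hsmooth a).continuous.continuousAt.eventually_mem
        (ψ₀.open_source.mem_nhds (by rwa [smul_one]))
    · exact (e.continuousAt he1).eventually (hθeq a)
  obtain ⟨S, hS, hSo, h1S⟩ := eventually_nhds_iff.mp hev
  let ψ := ψ₀.restrOpen S hSo
  have hψs : ψ.source ⊆ ψ₀.source ∩ S := (ψ₀.restrOpen_source S hSo).le
  have hψv : ∀ h, ψ h = θ (e h) := fun h => hφ (e h)
  have hψsub : ∀ h ∈ ψ.source, h ∈ e.source ∧ e h ∈ φ.source := fun h hh => by
    have := (hψs hh).1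
    rwa [OpenPartialHomeomorph.trans_source] at this
  let V : Submodule ℝ E :=
    { carrier := {v | ∀ a, L a v = v}
      add_mem' := fun hv hw a => by rw [map_add, hv a, hw a]
      zero_mem' := fun a => map_zero _
      smul_mem' := fun c v hv a => by rw [map_smul, hv a] }
  refine ⟨ψ, V, ?_, ?_, ?_, ?_, ?_⟩
  · rw [ψ₀.restrOpen_source S hSo]; exact ⟨hψ₀1, h1S⟩
  · rw [hψv]; exact hθ₀
  · intro h hh
    obtain ⟨h1, h2⟩ := hψsub h hh
    have h3 : ContMDiffAt 𝓘(ℝ, E) 𝓘(ℝ, E) ∞ θ (e h) := (hφs _ h2).contMDiffAt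
    have h4 : ContMDiffAt 𝓘(ℝ, E) 𝓘(ℝ, E) ∞ (fun h => θ (e h)) h :=
      h3.comp h (hes.contMDiffAt (e.open_source.mem_nhds h1))
    exact (h4.congr_of_eventuallyEq (Filter.Eventually.of_forall hψv)).contMDiffWithinAt
  · intro y hy
    have h0 : ψ.symm y ∈ ψ.source := ψ.map_target hy
    have hy' : y ∈ φ.target ∧ φ.symm y ∈ e.target := by
      have : y ∈ ψ₀.target := by
        rw [← ψ.right_inv hy]; exact ψ₀.map_source (hψs h0).1
      rwa [OpenPartialHomeomorph.trans_target] at this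
    have h3 : ContMDiffAt 𝓘(ℝ, E) 𝓘(ℝ, E) ∞ φ.symm y := (hφt y hy'.1).contMDiffAt
    have h4 : ContMDiffAt 𝓘(ℝ, E) 𝓘(ℝ, E) ∞ (fun y => e.symm (φ.symm y)) y :=
      (het.contMDiffAt (e.open_target.mem_nhds hy'.2)).comp y h3
    exact h4.contMDiffWithinAt
  · intro h hh
    obtain ⟨h1, h2⟩ := hψsub h hh
    have hf : ∀ a, θ (e (a • h)) = L a (θ (e h)) := fun a => by
      rw [← (hS h (hψs hh).2 a).2]
      simp only [f]
      rw [e.left_inv h1]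
    rw [hψv]
    constructor
    · intro hfix a
      rw [← hf, hfix]
    · intro hV a
      -- The larger chart `ψ₀` is needed: `a • h` may leave the source of `ψ`, while `S` was chosen
      -- to keep it in that of `ψ₀`.
      refine ψ₀.injOn ((hS h (hψs hh).2 a).1) (hψs hh).1 ?_
      change φ (e (a • h)) = φ (e h)
      rw [hφ, hφ, hf, hV a]

/-! ## Slices for a compact torus -/

/-- The derivative of a local multiplication at the identity is addition. -/
theorem hasFDerivAt_localMul {E : Type*} [NormedAddCommGroup E] [NormedSpace ℝ E]
    {m : E × E → E} (hm : DifferentiableAt ℝ m (0, 0))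
    (hm1 : ∀ᶠ x in 𝓝 (0 : E), m (x, 0) = x) (hm2 : ∀ᶠ x in 𝓝 (0 : E), m (0, x) = x) :
    HasFDerivAt m (ContinuousLinearMap.fst ℝ E E + ContinuousLinearMap.snd ℝ E E) (0, 0) := by
  have h1 : (fderiv ℝ m (0, 0)).comp (ContinuousLinearMap.inl ℝ E E) =
      ContinuousLinearMap.id ℝ E :=
    (HasFDerivAt.comp (f := fun x : E => (x, (0 : E))) (0 : E) hm.hasFDerivAt
      (hasFDerivAt_prodMk_left (𝕜 := ℝ) (0 : E) (0 : E))).unique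
      ((hasFDerivAt_id (0 : E)).congr_of_eventuallyEq hm1)
  have h2 : (fderiv ℝ m (0, 0)).comp (ContinuousLinearMap.inr ℝ E E) =
      ContinuousLinearMap.id ℝ E :=
    (HasFDerivAt.comp (f := fun x : E => ((0 : E), x)) (0 : E) hm.hasFDerivAt
      (hasFDerivAt_prodMk_right (𝕜 := ℝ) (0 : E) (0 : E))).unique
      ((hasFDerivAt_id (0 : E)).congr_of_eventuallyEq hm2)
  have h3 : fderiv ℝ m (0, 0) =
      ContinuousLinearMap.fst ℝ E E + ContinuousLinearMap.snd ℝ E E := by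
    refine ContinuousLinearMap.ext fun p => ?_
    have e1 := congrArg (fun L : E →L[ℝ] E => L p.1) h1
    have e2 := congrArg (fun L : E →L[ℝ] E => L p.2) h2
    simp only [ContinuousLinearMap.comp_apply, ContinuousLinearMap.inl_apply,
      ContinuousLinearMap.inr_apply, ContinuousLinearMap.id_apply] at e1 e2
    change _ = p.1 + p.2
    rw [← Prod.fst_add_snd p, map_add, e1, e2]
    simp
  rw [← h3]
  exact hm.hasFDerivAt

/-- If a map takes values in a closed subspace, so does its derivative. -/
theorem HasFDerivAt.apply_mem {V E : Type*} [NormedAddCommGroup V] [NormedSpace ℝ V]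
    [NormedAddCommGroup E] [NormedSpace ℝ E] {y : V → E} {D : V →L[ℝ] E} {x : V}
    (h : HasFDerivAt y D x) {S : Submodule ℝ E} (hS : IsClosed (S : Set E))
    (hy : ∀ᶠ u in 𝓝 x, y u ∈ S) (v : V) : D v ∈ S := by
  have hc : Filter.Tendsto (fun n : ℕ => ‖(n : ℝ)‖) Filter.atTop Filter.atTop := by
    simpa using tendsto_natCast_atTop_atTop (R := ℝ)
  -- `D v` is the limit of the quotients `n • (y (x + n⁻¹ • v) - y x)`, which lie in `S`.
  have ht := h.lim v hc
  refine hS.mem_of_tendsto ht ?_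
  have h0 : Filter.Tendsto (fun n : ℕ => x + (n : ℝ)⁻¹ • v) Filter.atTop (𝓝 x) := by
    have := (tendsto_inv_atTop_nhds_zero_nat (𝕜 := ℝ)).smul_const v
    simpa using this.const_add x
  filter_upwards [h0.eventually hy] with n hn
  exact S.smul_mem _ (S.sub_mem hn hy.self_of_nhds)

/-- Around the coset of `g` there is a smooth chart of `G/T` adapted to the submanifold
`ψ ⁻¹' V` of `G`, provided that this submanifold contains the conjugate of the torus by `g`. -/
theorem exists_slice_chart {E G : Type*} [NormedAddCommGroup E] [NormedSpace ℝ E]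
    [FiniteDimensional ℝ E] [TopologicalSpace G] [ChartedSpace E G] [Group G]
    [IsTopologicalGroup G] [LieGroup 𝓘(ℝ, E) ∞ G]
    {ψ : OpenPartialHomeomorph G E} {V : Submodule ℝ E} (h1ψ : 1 ∈ ψ.source) (hψ1 : ψ 1 = 0)
    (hψs : ContMDiffOn 𝓘(ℝ, E) 𝓘(ℝ, E) ∞ ψ ψ.source)
    (hψt : ContMDiffOn 𝓘(ℝ, E) 𝓘(ℝ, E) ∞ ψ.symm ψ.target)
    {T : Subgroup G} {k : ℕ} {s : (Fin k → ℝ) → G} (hs : Continuous s)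
    (hsadd : ∀ u v, s (u + v) = s u * s v) (hsT : ∀ u, s u ∈ T)
    (hsinj : ∀ᶠ u in 𝓝 0, s u = 1 → u = 0)
    (hsopen : ∀ N ∈ 𝓝 (0 : Fin k → ℝ), ∃ O ∈ 𝓝 (1 : G), ∀ t ∈ T, t ∈ O → ∃ u ∈ N, s u = t)
    (g : G) (hgV : ∀ u, g * s u * g⁻¹ ∈ ψ.source → ψ (g * s u * g⁻¹) ∈ V)
    {O : Set G} (hO : O ∈ 𝓝 (1 : G)) :
    ∃ φ : OpenPartialHomeomorph (G ⧸ T)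
        (EuclideanSpace ℝ (Fin (Module.finrank ℝ V - k)) ×
          EuclideanSpace ℝ (Fin (Module.finrank ℝ E - Module.finrank ℝ V))),
      (g : G ⧸ T) ∈ φ.source ∧ HomogeneousSpace.IsSmoothChart (E := E) T φ ∧
      ∀ w ∈ φ.target, ∃ h ∈ ψ.source, h ∈ O ∧ φ.symm w = ((h * g : G) : G ⧸ T) ∧
        (ψ h ∈ V ↔ w.2 = 0) := by
  have h0ψ : (0 : E) ∈ ψ.target := hψ1 ▸ ψ.map_source h1ψ
  have hψ0 : ψ.symm 0 = 1 := by rw [← hψ1, ψ.left_inv h1ψ]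
  have hs0 : s 0 = 1 := by simpa using hsadd 0 0
  let y : (Fin k → ℝ) → E := fun u => ψ (g * s u * g⁻¹)
  let m : E × E → E := fun p => ψ (ψ.symm p.1 * ψ.symm p.2)
  have hy0 : y 0 = 0 := by simp only [y, hs0, mul_one, mul_inv_cancel, hψ1]
  have hysrc : ∀ᶠ u in 𝓝 (0 : Fin k → ℝ), g * s u * g⁻¹ ∈ ψ.source := by
    have : ContinuousAt (fun u => g * s u * g⁻¹) 0 := by fun_prop
    refine this.eventually_mem (ψ.open_source.mem_nhds ?_)
    simpa [hs0] using h1ψ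
  have hψc : ContinuousAt ψ.symm 0 := ψ.continuousAt_symm h0ψ
  have hmdom : ∀ᶠ p in 𝓝 ((0 : E), (0 : E)),
      p.1 ∈ ψ.target ∧ p.2 ∈ ψ.target ∧ ψ.symm p.1 * ψ.symm p.2 ∈ ψ.source := by
    have c1 : ContinuousAt (fun p : E × E => ψ.symm p.1) (0, 0) :=
      ContinuousAt.comp (f := Prod.fst) hψc continuousAt_fst
    have c2 : ContinuousAt (fun p : E × E => ψ.symm p.2) (0, 0) :=
      ContinuousAt.comp (f := Prod.snd) hψc continuousAt_snd
    refine Filter.Eventually.and ?_ (Filter.Eventually.and ?_ ?_)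
    · exact continuousAt_fst.eventually_mem (ψ.open_target.mem_nhds h0ψ)
    · exact continuousAt_snd.eventually_mem (ψ.open_target.mem_nhds h0ψ)
    · exact (c1.mul c2).eventually_mem (ψ.open_source.mem_nhds (by simpa [hψ0] using h1ψ))
  have hm : ∀ᶠ p in 𝓝 ((0 : E), (0 : E)), ContDiffAt ℝ ∞ m p := by
    filter_upwards [hmdom] with p hp
    rw [← contMDiffAt_iff_contDiffAt]
    have c1 : ContMDiffAt 𝓘(ℝ, E × E) 𝓘(ℝ, E) ∞ (fun p : E × E => ψ.symm p.1) p :=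
      (hψt.contMDiffAt (ψ.open_target.mem_nhds hp.1)).comp p contDiffAt_fst.contMDiffAt
    have c2 : ContMDiffAt 𝓘(ℝ, E × E) 𝓘(ℝ, E) ∞ (fun p : E × E => ψ.symm p.2) p :=
      (hψt.contMDiffAt (ψ.open_target.mem_nhds hp.2.1)).comp p contDiffAt_snd.contMDiffAt
    exact (hψs.contMDiffAt (ψ.open_source.mem_nhds hp.2.2)).comp p (c1.mul c2)
  have hm1 : ∀ᶠ x in 𝓝 (0 : E), m (x, 0) = x := by
    filter_upwards [ψ.open_target.mem_nhds h0ψ] with x hx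
    simp only [m, hψ0, mul_one]
    exact ψ.right_inv hx
  have hm2 : ∀ᶠ x in 𝓝 (0 : E), m (0, x) = x := by
    filter_upwards [ψ.open_target.mem_nhds h0ψ] with x hx
    simp only [m, hψ0, one_mul]
    exact ψ.right_inv hx
  have hyc : ∀ᶠ u in 𝓝 (0 : Fin k → ℝ), ContinuousAt y u := by
    filter_upwards [hysrc] with u hu
    exact ContinuousAt.comp (f := fun u => g * s u * g⁻¹) (ψ.continuousAt hu) (by fun_prop)
  have hadd : ∀ᶠ p in 𝓝 ((0 : Fin k → ℝ), (0 : Fin k → ℝ)),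
      y (p.1 + p.2) = m (y p.1, y p.2) := by
    filter_upwards [continuousAt_fst.eventually hysrc, continuousAt_snd.eventually hysrc]
      with p hp1 hp2
    simp only [y, m]
    rw [ψ.left_inv hp1, ψ.left_inv hp2, hsadd]
    congr 1
    group
  obtain ⟨hysm, hyker⟩ := localHom_smooth hm hm1 hy0 hyc hadd
  have hyd : HasFDerivAt y (fderiv ℝ y 0) 0 :=
    (hysm.self_of_nhds.differentiableAt (by simp)).hasFDerivAt
  -- In a direction killed by the derivative, `y` is locally constant, so `s (t • v) = 1` for small
  -- `t`; local injectivity of `s` then forces `v = 0`.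
  have hDinj : ∀ v, fderiv ℝ y 0 v = 0 → v = 0 := by
    intro v hv
    have hc : Filter.Tendsto (fun t : ℝ => t • v) (𝓝 0) (𝓝 0) :=
      (by fun_prop : Continuous fun t : ℝ => t • v).tendsto' _ _ (zero_smul ℝ v)
    have hev : ∀ᶠ t in 𝓝 (0 : ℝ), t • v = 0 := by
      filter_upwards [hyker v hv, hc.eventually hysrc, hc.eventually hsinj] with t h1 h2 h3
      refine h3 ?_
      have h4 : g * s (t • v) * g⁻¹ = 1 := ψ.injOn h2 h1ψ (h1.trans hψ1.symm)
      simpa using h4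
    obtain ⟨t, ht, ht0⟩ := ((hev.filter_mono nhdsWithin_le_nhds).and
      (self_mem_nhdsWithin (a := (0 : ℝ)) (s := {0}ᶜ))).exists
    exact (smul_eq_zero.mp ht).resolve_left ht0
  have hDV : ∀ v, fderiv ℝ y 0 v ∈ V :=
    hyd.apply_mem V.closed_of_finiteDimensional (hysrc.mono fun u hu => hgV u hu)
  obtain ⟨P, hPV, e, he⟩ := exists_flag_splitting V (fderiv ℝ y 0) hDinj hDV
  set F := EuclideanSpace ℝ (Fin (Module.finrank ℝ V - k)) ×
    EuclideanSpace ℝ (Fin (Module.finrank ℝ E - Module.finrank ℝ V)) with hF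
  -- In the chart `ψ` this is the product of a slice element and an element of `g T g⁻¹`. Its
  -- derivative at the origin is the splitting `e`, so it gives local coordinates `(w, u)` on `G`
  -- with `u` running along the cosets.
  let Θ : F × (Fin k → ℝ) → E := fun q => m (P q.1, y q.2)
  have hq0 : ContinuousAt (fun q : F × (Fin k → ℝ) => (P q.1, y q.2)) (0, 0) :=
    (by fun_prop : ContinuousAt (fun q : F × (Fin k → ℝ) => P q.1) (0, 0)).prodMk
      (ContinuousAt.comp (f := Prod.snd) (x := ((0 : F), (0 : Fin k → ℝ)))
        hyc.self_of_nhds continuousAt_snd)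
  have hq00 : (P (0 : F), y 0) = (0, 0) := by rw [map_zero, hy0]
  have hΘs : ∀ᶠ q in 𝓝 ((0 : F), (0 : Fin k → ℝ)), ContDiffAt ℝ ∞ Θ q := by
    have h1 := hq0.eventually (p := fun p => ContDiffAt ℝ ∞ m p) (by simpa only [hq00] using hm)
    filter_upwards [h1, continuousAt_snd.eventually hysm] with q hq1 hq2
    exact ContDiffAt.comp (g := m) (f := fun q : F × (Fin k → ℝ) => (P q.1, y q.2)) q hq1
      ((P.contDiff.contDiffAt.comp q contDiffAt_fst).prodMk
      (hq2.comp q contDiffAt_snd))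
  have hΘd : HasFDerivAt Θ (e : F × (Fin k → ℝ) →L[ℝ] E) (0, 0) := by
    have h1 : HasFDerivAt m (ContinuousLinearMap.fst ℝ E E + ContinuousLinearMap.snd ℝ E E)
        (P (0 : F), y 0) := by
      rw [hq00]
      exact hasFDerivAt_localMul (hm.self_of_nhds.differentiableAt (by simp)) hm1 hm2
    have h2 : HasFDerivAt (fun q : F × (Fin k → ℝ) => (P q.1, y q.2))
        ((P.comp (ContinuousLinearMap.fst ℝ F (Fin k → ℝ))).prod
          ((fderiv ℝ y 0).comp (ContinuousLinearMap.snd ℝ F (Fin k → ℝ)))) (0, 0) :=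
      (P.hasFDerivAt.comp ((0 : F), (0 : Fin k → ℝ)) hasFDerivAt_fst).prodMk
        (HasFDerivAt.comp (f := Prod.snd) ((0 : F), (0 : Fin k → ℝ)) hyd hasFDerivAt_snd)
    have h3 := HasFDerivAt.comp (f := fun q : F × (Fin k → ℝ) => (P q.1, y q.2))
      ((0 : F), (0 : Fin k → ℝ)) h1 h2
    convert! h3
    refine ContinuousLinearMap.ext fun q => ?_
    exact he q.1 q.2
  obtain ⟨χ, hχ0, hχ, hχs, hχt⟩ := exists_smooth_openPartialHomeomorph e hΘs hΘd
  let c : F → G := fun w => ψ.symm (P w) * g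
  have hPc : ContinuousAt (fun w : F => ψ.symm (P w)) 0 :=
    ContinuousAt.comp (f := fun w : F => P w) (by rwa [map_zero]) (by fun_prop)
  have hc0 : ContinuousAt c 0 := hPc.mul continuousAt_const
  have hdom : ∀ᶠ q in 𝓝 ((0 : F), (0 : Fin k → ℝ)), q ∈ χ.source ∧ P q.1 ∈ ψ.target ∧
      g * s q.2 * g⁻¹ ∈ ψ.source ∧ ψ.symm (P q.1) * (g * s q.2 * g⁻¹) ∈ ψ.source := by
    refine Filter.Eventually.and (χ.open_source.mem_nhds hχ0) (Filter.Eventually.and ?_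
      (Filter.Eventually.and (hysrc.prod_inr_nhds _) ?_))
    · have : ContinuousAt (fun q : F × (Fin k → ℝ) => P q.1) (0, 0) := by fun_prop
      exact this.eventually_mem (ψ.open_target.mem_nhds (by simpa using h0ψ))
    · have h1 : ContinuousAt (fun q : F × (Fin k → ℝ) => ψ.symm (P q.1)) (0, 0) :=
        ContinuousAt.comp (f := Prod.fst) (x := ((0 : F), (0 : Fin k → ℝ))) hPc continuousAt_fst
      have h2 : ContinuousAt (fun q : F × (Fin k → ℝ) => g * s q.2 * g⁻¹) (0, 0) := by fun_prop
      exact (h1.mul h2).eventually_mem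
        (ψ.open_source.mem_nhds (by simpa [hψ0, hs0] using h1ψ))
  obtain ⟨W₀, hW₀, U₀, hU₀, hWU₀⟩ := mem_nhds_prod_iff.mp hdom
  obtain ⟨U, hUU₀, hUo, h0U⟩ := mem_nhds_iff.mp hU₀
  obtain ⟨O', hO', hO'T⟩ := hsopen U (hUo.mem_nhds h0U)
  -- Two slice points in one coset differ by an element of `T`; on `W₁` it is close enough to one to
  -- be `s u` with `u ∈ U`. This rules out that a coset returns to the slice from afar.
  obtain ⟨W₁, hW₁, hW₁O'⟩ : ∃ W₁ ∈ 𝓝 (0 : F), ∀ w ∈ W₁, ∀ w' ∈ W₁, (c w)⁻¹ * c w' ∈ O' := by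
    have h1 : ContinuousAt (fun p : F × F => (c p.1)⁻¹ * c p.2) (0, 0) :=
      (ContinuousAt.comp (f := Prod.fst) (x := ((0 : F), (0 : F))) hc0 continuousAt_fst).inv.mul
        (ContinuousAt.comp (f := Prod.snd) (x := ((0 : F), (0 : F))) hc0 continuousAt_snd)
    have h2 : (fun p : F × F => (c p.1)⁻¹ * c p.2) ⁻¹' O' ∈ 𝓝 ((0 : F), (0 : F)) :=
      h1 (by simpa using hO')
    obtain ⟨A₁, hA₁, A₂, hA₂, h3⟩ := mem_nhds_prod_iff.mp h2
    exact ⟨A₁ ∩ A₂, Filter.inter_mem hA₁ hA₂, fun w hw w' hw' =>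
      h3 (show (w, w') ∈ A₁ ×ˢ A₂ from ⟨hw.1, hw'.2⟩)⟩
  have hWO : ∀ᶠ w in 𝓝 (0 : F), ψ.symm (P w) ∈ O :=
    hPc.eventually_mem (by rwa [map_zero, hψ0])
  obtain ⟨W, hWsub, hWop, h0W⟩ := mem_nhds_iff.mp
    (Filter.inter_mem (Filter.inter_mem hW₀ hW₁) hWO)
  have hWU : ∀ w ∈ W, ∀ u ∈ U, (w, u) ∈ χ.source ∧ P w ∈ ψ.target ∧
      g * s u * g⁻¹ ∈ ψ.source ∧ ψ.symm (P w) * (g * s u * g⁻¹) ∈ ψ.source :=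
    fun w hw u hu => hWU₀ (show (w, u) ∈ W₀ ×ˢ U₀ from ⟨(hWsub hw).1.1, hUU₀ hu⟩)
  have hPt : ∀ w ∈ W, P w ∈ ψ.target := fun w hw => (hWU w hw 0 h0U).2.1
  have hχv : ∀ w ∈ W, ∀ u ∈ U, χ (w, u) = ψ (ψ.symm (P w) * (g * s u * g⁻¹)) := by
    intro w hw u hu
    rw [hχ]
    simp only [Θ, m, y]
    rw [ψ.left_inv (hWU w hw u hu).2.2.1]
  have hχt' : ∀ w ∈ W, ∀ u ∈ U, χ (w, u) ∈ ψ.target := fun w hw u hu => by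
    rw [hχv w hw u hu]; exact ψ.map_source (hWU w hw u hu).2.2.2
  have hkey : ∀ w ∈ W, ∀ u ∈ U, ψ.symm (χ (w, u)) * g = c w * s u := by
    intro w hw u hu
    rw [hχv w hw u hu, ψ.left_inv (hWU w hw u hu).2.2.2]
    simp only [c]
    group
  have hχw0 : ∀ w ∈ W, χ (w, 0) = P w := fun w hw => by
    rw [hχv w hw 0 h0U, hs0, mul_one, mul_inv_cancel, mul_one, ψ.right_inv (hPt w hw)]
  let j : F → G ⧸ T := fun w => (c w : G ⧸ T)
  have hjinj : Set.InjOn j W := by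
    intro w hw w' hw' hj
    obtain ⟨u, hu, hsu⟩ := hO'T _ (QuotientGroup.eq.mp hj)
      (hW₁O' w (hWsub hw).1.2 w' (hWsub hw').1.2)
    have h1 : c w * s u = c w' * s 0 := by rw [hsu, hs0]; group
    rw [← hkey w hw u hu, ← hkey w' hw' 0 h0U] at h1
    have h2 := ψ.symm.injOn (hχt' w hw u hu) (hχt' w' hw' 0 h0U) (mul_right_cancel h1)
    exact (Prod.ext_iff.mp (χ.injOn (hWU w hw u hu).1 (hWU w' hw' 0 h0U).1 h2)).1
  have hcs : ContMDiffOn 𝓘(ℝ, F) 𝓘(ℝ, E) ∞ c W := by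
    intro w hw
    have h1 : ContMDiffAt 𝓘(ℝ, F) 𝓘(ℝ, E) ∞ (fun w : F => ψ.symm (P w)) w :=
      (hψt.contMDiffAt (ψ.open_target.mem_nhds (hPt w hw))).comp w
        P.contDiff.contDiffAt.contMDiffAt
    exact (h1.mul contMDiffAt_const).contMDiffWithinAt
  have hjc : ContinuousOn j W := QuotientGroup.continuous_mk.comp_continuousOn hcs.continuousOn
  -- Since `c w * s u` and `c w` define the same coset, the image is unchanged when `S` is thickened
  -- by `U` to an open subset of `G`, and the projection is open.
  have hjo : ∀ S ⊆ W, IsOpen S → IsOpen (j '' S) := by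
    intro S hSW hS
    have himg : j '' S = (fun h : G => (h : G ⧸ T)) ''
        ((fun h : G => h * g) '' (ψ.symm '' (χ '' (S ×ˢ U)))) := by
      ext z
      simp only [Set.mem_image, exists_exists_and_eq_and]
      constructor
      · rintro ⟨w, hw, rfl⟩
        refine ⟨(w, 0), ⟨hw, h0U⟩, ?_⟩
        rw [hkey w (hSW hw) 0 h0U, hs0, mul_one]
      · rintro ⟨⟨w, u⟩, ⟨hw, hu⟩, rfl⟩
        refine ⟨w, hw, ?_⟩
        rw [hkey w (hSW hw) u hu]
        exact QuotientGroup.eq.mpr (by simpa using hsT u)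
    rw [himg]
    refine QuotientGroup.isOpenMap_coe _ ((Homeomorph.mulRight g).isOpenMap _ ?_)
    refine ψ.symm.isOpen_image_of_subset_source
      (χ.isOpen_image_of_subset_source (hS.prod hUo) ?_) ?_
    · rintro ⟨w, u⟩ ⟨hw, hu⟩
      exact (hWU w (hSW hw) u hu).1
    · rintro _ ⟨⟨w, u⟩, ⟨hw, hu⟩, rfl⟩
      exact hχt' w (hSW hw) u hu
  let pe : PartialEquiv F (G ⧸ T) := hjinj.toPartialEquiv
  have hjo' : IsOpenMap (pe.source.domRestrict pe) := by
    intro S hS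
    have h1 : pe.source.domRestrict pe '' S = j '' (Subtype.val '' S) := by
      rw [Set.image_image]; rfl
    rw [h1]
    exact hjo _ (by rintro _ ⟨x, -, rfl⟩; exact x.2) (hWop.isOpenMap_subtype_val _ hS)
  let φ := (OpenPartialHomeomorph.ofContinuousOpenRestrict pe hjc hjo' hWop).symm
  have hφt : φ.target = W := rfl
  have hφs : φ.source = j '' W := rfl
  have hφj : ∀ w ∈ W, φ (j w) = w := fun w hw => φ.right_inv (x := w) hw
  refine ⟨φ, ⟨0, h0W, ?_⟩, ⟨?_, ?_⟩, ?_⟩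
  · change ((ψ.symm (P 0) * g : G) : G ⧸ T) = g
    rw [map_zero, hψ0, one_mul]
  -- A representative `h` need not be near the slice. Right translation by the `t ∈ T` with `h * t =
  -- c w₀` moves it there without changing its coset, and the chart is then the first component of
  -- `χ.symm`.
  · rintro h ⟨w₀, hw₀, hjw⟩
    have ht : h⁻¹ * c w₀ ∈ T := QuotientGroup.eq.mp hjw.symm
    set t := h⁻¹ * c w₀ with ht_def
    have hht : h * t * g⁻¹ = ψ.symm (P w₀) := by
      simp only [ht_def, c]; group
    have hr : ContMDiffAt 𝓘(ℝ, E) 𝓘(ℝ, E) ∞ (fun h' : G => h' * t * g⁻¹) h :=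
      (contMDiffAt_id.mul contMDiffAt_const).mul contMDiffAt_const
    have hsrc : h * t * g⁻¹ ∈ ψ.source := by
      rw [hht]; exact ψ.map_target (hPt w₀ hw₀)
    have hval : ψ (h * t * g⁻¹) = χ (w₀, 0) := by
      rw [hht, ψ.right_inv (hPt w₀ hw₀), hχw0 w₀ hw₀]
    have hχtgt : ψ (h * t * g⁻¹) ∈ χ.target := by
      rw [hval]; exact χ.map_source (hWU w₀ hw₀ 0 h0U).1
    have h2 : ContMDiffAt 𝓘(ℝ, E) 𝓘(ℝ, E) ∞ (fun h' : G => ψ (h' * t * g⁻¹)) h :=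
      (hψs.contMDiffAt (ψ.open_source.mem_nhds hsrc)).comp h hr
    have h3 : ContMDiffAt 𝓘(ℝ, E) 𝓘(ℝ, F × (Fin k → ℝ)) ∞
        (fun h' : G => χ.symm (ψ (h' * t * g⁻¹))) h :=
      (hχt _ hχtgt).contMDiffAt.comp h h2
    have h4 : ContMDiffAt 𝓘(ℝ, E) 𝓘(ℝ, F) ∞
        (fun h' : G => (χ.symm (ψ (h' * t * g⁻¹))).1) h :=
      ContMDiffAt.comp (g := Prod.fst) (I' := 𝓘(ℝ, F × (Fin k → ℝ))) h
        contDiffAt_fst.contMDiffAt h3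
    refine (h4.congr_of_eventuallyEq ?_).contMDiffWithinAt
    have e1 := hr.continuousAt.eventually_mem (ψ.open_source.mem_nhds hsrc)
    have e2 := h2.continuousAt.eventually_mem (χ.open_target.mem_nhds hχtgt)
    have e3 := h3.continuousAt.eventually_mem (s := W ×ˢ U) ((hWop.prod hUo).mem_nhds (by
      rw [hval, χ.left_inv (hWU w₀ hw₀ 0 h0U).1]; exact ⟨hw₀, h0U⟩))
    filter_upwards [e1, e2, e3] with h' h1' h2' h3'
    set q := χ.symm (ψ (h' * t * g⁻¹)) with hq
    have e4 : χ (q.1, q.2) = ψ (h' * t * g⁻¹) := χ.right_inv h2'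
    have e5 : h' * t = c q.1 * s q.2 := by
      rw [← hkey q.1 h3'.1 q.2 h3'.2, e4, ψ.left_inv h1']; group
    have e6 : (h' : G ⧸ T) = j q.1 := by
      refine QuotientGroup.eq.mpr ?_
      have e7 : h'⁻¹ * c q.1 = t * (s q.2)⁻¹ := by
        rw [eq_mul_inv_iff_mul_eq, mul_assoc, ← e5]; group
      rw [e7]
      exact T.mul_mem ht (T.inv_mem (hsT _))
    rw [e6, hφj _ h3'.1]
  · intro w hw
    exact ⟨W, hWop.mem_nhds hw, c, hcs, fun z _ => rfl⟩
  · intro w hw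
    refine ⟨ψ.symm (P w), ψ.map_target (hPt w hw), (hWsub hw).2, rfl, ?_⟩
    rw [ψ.right_inv (hPt w hw)]
    exact hPV w

/-! ## The invariants of `G` and of `G/T` -/

section Invariants

variable {A G : Type*} [Group A] [Group G] [TopologicalSpace G] [IsTopologicalGroup G]
  [MulDistribMulAction A G]

theorem smul_eq_of_mem_invariantsIdentityComponent {h : G}
    (hh : h ∈ invariantsIdentityComponent A G) (a : A) : a • h = h := by
  obtain ⟨s, -, rfl⟩ := hh
  exact s.2 a

theorem coe_invariantsIdentityComponent :
    (invariantsIdentityComponent A G : Set G) =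
      Subtype.val '' connectedComponent (1 : FixedPoints.subgroup A G) := rfl

theorem isPreconnected_invariantsIdentityComponent :
    IsPreconnected (invariantsIdentityComponent A G : Set G) := by
  rw [coe_invariantsIdentityComponent]
  exact isPreconnected_connectedComponent.image _ continuous_subtype_val.continuousOn

theorem isClosed_invariantsIdentityComponent [T2Space G]
    (hA : ∀ a : A, Continuous fun g : G => a • g) :
    IsClosed (invariantsIdentityComponent A G : Set G) := by
  have h1 : IsClosed (FixedPoints.subgroup A G : Set G) := by
    have : (FixedPoints.subgroup A G : Set G) = ⋂ a : A, {g | a • g = g} := by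
      ext g; simp [FixedPoints.mem_subgroup]
    rw [this]
    exact isClosed_iInter fun a => isClosed_eq (hA a) continuous_id
  rw [coe_invariantsIdentityComponent]
  exact h1.isClosedEmbedding_subtypeVal.isClosedMap _ isClosed_connectedComponent

/-- If the invariants form a linear subspace in a chart around the identity, then those close to
the identity lie in the identity component. -/
theorem mem_invariantsIdentityComponent_of_near_one {E : Type*} [NormedAddCommGroup E]
    [NormedSpace ℝ E] {ψ : OpenPartialHomeomorph G E} {V : Submodule ℝ E} (h1 : 1 ∈ ψ.source)
    (hψ1 : ψ 1 = 0) (hV : ∀ h ∈ ψ.source, (∀ a : A, a • h = h) ↔ ψ h ∈ V) :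
    ∃ O ∈ 𝓝 (1 : G), ∀ h ∈ O, (∀ a : A, a • h = h) → h ∈ invariantsIdentityComponent A G := by
  have h0 : (0 : E) ∈ ψ.target := hψ1 ▸ ψ.map_source h1
  obtain ⟨r, hr, hball⟩ := Metric.mem_nhds_iff.mp (ψ.open_target.mem_nhds h0)
  refine ⟨ψ.source ∩ ψ ⁻¹' Metric.ball 0 r, Filter.inter_mem (ψ.open_source.mem_nhds h1)
    ((ψ.continuousAt h1).preimage_mem_nhds ?_), ?_⟩
  · rw [hψ1]; exact Metric.ball_mem_nhds _ hr
  · rintro h ⟨hs, hb⟩ hfix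
    -- A convex piece of `V`, hence a connected set of invariants joining `h` to one.
    let S : Set G := ψ.symm '' ((V : Set E) ∩ Metric.ball 0 r)
    have hSp : IsPreconnected S :=
      (V.convex.inter (convex_ball (0 : E) r)).isPreconnected.image _
        (ψ.symm.continuousOn.mono fun x hx => hball hx.2)
    have hSfix : ∀ g ∈ S, g ∈ FixedPoints.subgroup A G := by
      rintro _ ⟨x, ⟨hxV, hxr⟩, rfl⟩
      refine fun a => (hV _ (ψ.map_target (hball hxr))).mpr ?_ a
      rwa [ψ.right_inv (hball hxr)]
    have himg : Subtype.val '' {g : FixedPoints.subgroup A G | (g : G) ∈ S} = S :=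
      Set.Subset.antisymm (by rintro _ ⟨g, hg, rfl⟩; exact hg)
        fun g hg => ⟨⟨g, hSfix g hg⟩, hg, rfl⟩
    have hS' : IsPreconnected {g : FixedPoints.subgroup A G | (g : G) ∈ S} :=
      Topology.IsInducing.subtypeVal.isPreconnected_image.mp (himg.symm ▸ hSp)
    have h1S : (1 : G) ∈ S := ⟨0, ⟨V.zero_mem, Metric.mem_ball_self hr⟩, by
      rw [← hψ1, ψ.left_inv h1]⟩
    have hhS : h ∈ S := ⟨ψ h, ⟨(hV h hs).mp hfix, hb⟩, ψ.left_inv hs⟩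
    exact ⟨⟨h, hSfix h hhS⟩, hS'.subset_connectedComponent (x := 1) h1S hhS, rfl⟩

end Invariants

/-! ### Torsion in compact tori -/

section Torus

variable {G : Type*} [Group G] [TopologicalSpace G] {T : Subgroup G}

theorem IsCompactTorus.isClosed [T2Space G] (hT : IsCompactTorus T) : IsClosed (T : Set G) := by
  obtain ⟨k, ⟨χ⟩⟩ := hT
  have : CompactSpace T := χ.toHomeomorph.symm.compactSpace
  exact (isCompact_iff_compactSpace.mpr this).isClosed

theorem IsCompactTorus.mul_comm (hT : IsCompactTorus T) {s t : G} (hs : s ∈ T) (ht : t ∈ T) :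
    s * t = t * s := by
  obtain ⟨k, ⟨χ⟩⟩ := hT
  have h : (⟨s, hs⟩ * ⟨t, ht⟩ : T) = ⟨t, ht⟩ * ⟨s, hs⟩ := χ.injective (by
    rw [map_mul, map_mul, _root_.mul_comm])
  exact congrArg Subtype.val h

/-- The elements of a compact torus killed by a given exponent form a discrete set. -/
theorem IsCompactTorus.exists_nhds_torsion (hT : IsCompactTorus T) {n : ℕ} (hn : n ≠ 0) :
    ∃ O ∈ 𝓝 (1 : G), ∀ t ∈ T, t ∈ O → t ^ n = 1 → t = 1 := by
  obtain ⟨k, s, -, hadd, -, hinj, hopen⟩ := hT.exists_param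
  have hs0 : s 0 = 1 := by simpa using hadd 0 0
  have hpow : ∀ (j : ℕ) u, s (j • u) = s u ^ j := by
    intro j u
    induction j with
    | zero => simp [hs0]
    | succ j ih => rw [succ_nsmul, hadd, ih, pow_succ]
  -- For `t = s u` with `u` so small that `n • u` lies where `s` is injective at one, `t ^ n = s (n
  -- • u) = 1` forces `u = 0`.
  have hc : Filter.Tendsto (fun u : Fin k → ℝ => n • u) (𝓝 0) (𝓝 0) :=
    (by fun_prop : Continuous fun u : Fin k → ℝ => n • u).tendsto' _ _ (smul_zero n)
  obtain ⟨O, hO, h⟩ := hopen _ (hc.eventually hinj)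
  refine ⟨O, hO, fun t ht htO htn => ?_⟩
  obtain ⟨u, hu, rfl⟩ := h t ht htO
  have h1 : n • u = 0 := hu (by rw [hpow, htn])
  rw [(smul_eq_zero.mp h1).resolve_left hn, hs0]

end Torus

open NonabelianCohomology

/-! ### Rigidity of cocycles and components as orbits -/

section Coboundary

variable {A G : Type*} [Group A] [Group G] [MulDistribMulAction A G]
  {T : Subgroup G} [IsSubmodule A T]

theorem mk_mem_H0_iff (g : G) : (g : G ⧸ T) ∈ H0 A (G ⧸ T) ↔ ∀ a : A, g⁻¹ * a • g ∈ T := by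
  rw [MulAction.mem_fixedPoints]
  refine forall_congr' fun a => ?_
  rw [eq_comm]
  exact QuotientGroup.eq

/-- With trivial action on `T`, a cocycle is a homomorphism, so its values have order dividing that
of `A`. -/
theorem pow_card_cocycle [Finite A] (hTA : ∀ t ∈ T, ∀ a : A, a • t = t) {g : G}
    (hg : (g : G ⧸ T) ∈ H0 A (G ⧸ T)) (a : A) : (g⁻¹ * a • g) ^ Nat.card A = 1 := by
  have h : ∀ j : ℕ, (g⁻¹ * a • g) ^ j = g⁻¹ * (a ^ j) • g := by
    intro j
    induction j with
    | zero => simp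
    | succ j ih =>
      -- Replacing the last factor by its translate under `a ^ j` makes the product telescope.
      have h1 := hTA _ ((mk_mem_H0_iff g).mp hg a) (a ^ j)
      rw [pow_succ, ih, ← h1, smul_mul', smul_inv', smul_smul, ← pow_succ]
      group
  rw [h, pow_card_eq_one', one_smul, inv_mul_cancel]

theorem smul_mem_H0 {l : G} (hl : ∀ a : A, a • l = l) {x : G ⧸ T} (hx : x ∈ H0 A (G ⧸ T)) :
    l • x ∈ H0 A (G ⧸ T) := by
  induction x using QuotientGroup.induction_on with
  | H g =>
    change ((l * g : G) : G ⧸ T) ∈ _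
    rw [mk_mem_H0_iff] at hx ⊢
    intro a
    rw [smul_mul', hl, mul_inv_rev, mul_assoc, inv_mul_cancel_left]
    exact hx a

/-- The coboundary operator is constant on orbits of the group of invariants. -/
theorem coboundary_eq_of_smul {l : G} (hl : ∀ a : A, a • l = l) {x y : H0 A (G ⧸ T)}
    (h : (y : G ⧸ T) = l • (x : G ⧸ T)) : coboundary T y = coboundary T x := by
  obtain ⟨x, hx⟩ := x
  obtain ⟨y, hy⟩ := y
  induction x using QuotientGroup.induction_on with
  | H g =>
    obtain rfl : y = ((l * g : G) : G ⧸ T) := h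
    rw [coboundary_mk, coboundary_mk]
    congr 1
    refine Subtype.ext (funext fun a => Subtype.ext ?_)
    change (l * g)⁻¹ * a • (l * g) = g⁻¹ * a • g
    rw [smul_mul', hl, mul_inv_rev, mul_assoc, inv_mul_cancel_left]

variable [TopologicalSpace G] [IsTopologicalGroup G]

theorem isClosed_H0 (hA : ∀ a : A, Continuous fun g : G => a • g) (hT : IsClosed (T : Set G)) :
    IsClosed (H0 A (G ⧸ T)) := by
  rw [← (QuotientGroup.isQuotientMap_mk (N := T)).isClosed_preimage]
  have : ((↑) : G → G ⧸ T) ⁻¹' H0 A (G ⧸ T) = ⋂ a : A, {g | g⁻¹ * a • g ∈ T} := by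
    ext g
    rw [Set.mem_preimage, mk_mem_H0_iff, Set.mem_iInter]
    rfl
  rw [this]
  exact isClosed_iInter fun a => hT.preimage (continuous_inv.mul (hA a))

/-- Invariant cosets close to a given one are translates of it by elements of `G₀ᴬ`. -/
theorem mul_inv_mem_of_near [Finite A] (hA : ∀ a : A, Continuous fun g : G => a • g)
    (hT : IsCompactTorus T) (hTA : ∀ t ∈ T, ∀ a : A, a • t = t)
    (hnear : ∃ O ∈ 𝓝 (1 : G), ∀ h ∈ O, (∀ a : A, a • h = h) →
      h ∈ invariantsIdentityComponent A G)
    {g : G} (hg : (g : G ⧸ T) ∈ H0 A (G ⧸ T)) :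
    ∀ᶠ h : G in 𝓝 g, (h : G ⧸ T) ∈ H0 A (G ⧸ T) → h * g⁻¹ ∈ invariantsIdentityComponent A G := by
  obtain ⟨O, hO, hOH⟩ := hnear
  obtain ⟨O', hO', htor⟩ := hT.exists_nhds_torsion (n := Nat.card A) Nat.card_pos.ne'
  have h1 : ∀ᶠ h in 𝓝 g, h * g⁻¹ ∈ O := by
    have : ContinuousAt (fun h => h * g⁻¹) g := by fun_prop
    exact this (by simpa using hO)
  have h2 : ∀ᶠ h in 𝓝 g, ∀ a : A, (h⁻¹ * a • h) * (g⁻¹ * a • g)⁻¹ ∈ O' := by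
    refine Filter.eventually_all.mpr fun a => ?_
    have : ContinuousAt (fun h => (h⁻¹ * a • h) * (g⁻¹ * a • g)⁻¹) g :=
      ((continuous_inv.mul (hA a)).mul continuous_const).continuousAt
    exact this (by simpa using hO')
  filter_upwards [h1, h2] with h h1 h2 hh
  refine hOH _ h1 fun a => ?_
  have hhT := (mk_mem_H0_iff h).mp hh a
  have hgT := (mk_mem_H0_iff g).mp hg a
  -- The quotient of the two values is a torsion element of the commutative group `T` close to one,
  -- hence trivial.
  have h3 : h⁻¹ * a • h = g⁻¹ * a • g := by
    rw [← mul_inv_eq_one]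
    refine htor _ (T.mul_mem hhT (T.inv_mem hgT)) (h2 a) ?_
    have hcomm : Commute (h⁻¹ * a • h) (g⁻¹ * a • g)⁻¹ := hT.mul_comm hhT (T.inv_mem hgT)
    rw [hcomm.mul_pow, inv_pow, pow_card_cocycle hTA hh, pow_card_cocycle hTA hg, inv_one, one_mul]
  rw [smul_mul', smul_inv', eq_mul_of_inv_mul_eq h3]
  group

/-- The connected components of the set of invariant cosets are orbits of `G₀ᴬ`. -/
theorem image_connectedComponent_H0 [Finite A] (hA : ∀ a : A, Continuous fun g : G => a • g)
    (hT : IsCompactTorus T) (hTA : ∀ t ∈ T, ∀ a : A, a • t = t)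
    (hnear : ∃ O ∈ 𝓝 (1 : G), ∀ h ∈ O, (∀ a : A, a • h = h) →
      h ∈ invariantsIdentityComponent A G) (x : H0 A (G ⧸ T)) :
    Subtype.val '' connectedComponent x =
      {y | ∃ l ∈ invariantsIdentityComponent A G, y = l • (x : G ⧸ T)} := by
  let H := invariantsIdentityComponent A G
  let orb : H0 A (G ⧸ T) → Set (H0 A (G ⧸ T)) := fun y => {z | ∃ l ∈ H, (z : G ⧸ T) = l • y}
  have hself : ∀ y, y ∈ orb y := fun y => ⟨1, H.one_mem, (one_smul _ _).symm⟩
  have htrans : ∀ {y z w}, z ∈ orb y → w ∈ orb z → w ∈ orb y := by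
    rintro y z w ⟨l, hl, h1⟩ ⟨l', hl', h2⟩
    exact ⟨l' * l, H.mul_mem hl' hl, by rw [h2, h1, mul_smul]⟩
  have hsymm : ∀ {y z}, z ∈ orb y → y ∈ orb z := by
    rintro y z ⟨l, hl, h1⟩
    exact ⟨l⁻¹, H.inv_mem hl, by rw [h1, inv_smul_smul]⟩
  have hnhds : ∀ y, orb y ∈ 𝓝 y := by
    rintro ⟨y, hy⟩
    induction y using QuotientGroup.induction_on with
    | H g =>
      have h1 := (QuotientGroup.isOpenMap_coe (N := T)).image_mem_nhds
        (mul_inv_mem_of_near hA hT hTA hnear hy)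
      filter_upwards [continuous_subtype_val.continuousAt.preimage_mem_nhds h1]
      rintro ⟨_, hz⟩ ⟨h, hh, rfl⟩
      refine ⟨h * g⁻¹, hh hz, ?_⟩
      change (h : G ⧸ T) = ((h * g⁻¹ * g : G) : G ⧸ T)
      rw [inv_mul_cancel_right]
  -- All orbits are open and they partition the fixed set, so each is also closed.
  have hclopen : IsClopen (orb x) := by
    refine ⟨⟨isOpen_iff_mem_nhds.mpr fun z hz => ?_⟩, isOpen_iff_mem_nhds.mpr fun z hz => ?_⟩
    · filter_upwards [hnhds z] with w hw hwx
      exact hz (htrans hwx (hsymm hw))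
    · filter_upwards [hnhds z] with w hw
      exact htrans hz hw
  have hpre : IsPreconnected (orb x) := by
    rw [← Topology.IsInducing.subtypeVal.isPreconnected_image]
    have himg : Subtype.val '' orb x = (fun l : G => l • (x : G ⧸ T)) '' (H : Set G) := by
      ext y
      constructor
      · rintro ⟨z, ⟨l, hl, h⟩, rfl⟩
        exact ⟨l, hl, h.symm⟩
      · rintro ⟨l, hl, rfl⟩
        exact ⟨⟨l • (x : G ⧸ T), smul_mem_H0
          (smul_eq_of_mem_invariantsIdentityComponent hl) x.2⟩, ⟨l, hl, rfl⟩, rfl⟩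
    rw [himg]
    refine isPreconnected_invariantsIdentityComponent.image _ (Continuous.continuousOn ?_)
    obtain ⟨g, hg⟩ := QuotientGroup.mk_surjective (x : G ⧸ T)
    rw [← hg]
    exact QuotientGroup.continuous_mk.comp (continuous_mul_const g)
  rw [(hclopen.connectedComponent_subset (hself x)).antisymm
    (hpre.subset_connectedComponent (hself x))]
  ext y
  constructor
  · rintro ⟨z, ⟨l, hl, h⟩, rfl⟩
    exact ⟨l, hl, h⟩
  · rintro ⟨l, hl, rfl⟩
    exact ⟨⟨l • (x : G ⧸ T), smul_mem_H0
      (smul_eq_of_mem_invariantsIdentityComponent hl) x.2⟩, ⟨l, hl, rfl⟩, rfl⟩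

end Coboundary

/-! ### Assembly of the theorem -/

/-- For a finite group `A` of smooth automorphisms and a compact torus `T` in `G₀ᴬ`, the connected
components of the set of invariant elements of `G/T` are closed homogeneous submanifolds on which
the coboundary operator is constant. -/
theorem isClosedHomogeneousSubmanifold_component_H0 {E G A : Type*} [NormedAddCommGroup E]
    [NormedSpace ℝ E] [FiniteDimensional ℝ E] [TopologicalSpace G] [T2Space G]
    [ChartedSpace E G] [Group G] [IsTopologicalGroup G] [LieGroup 𝓘(ℝ, E) ∞ G]
    [Group A] [Finite A] [MulDistribMulAction A G]
    (hsmooth : ∀ a : A, ContMDiff 𝓘(ℝ, E) 𝓘(ℝ, E) ∞ (fun g : G => a • g))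
    {T : Subgroup G} [IsSubmodule A T] (hTH : T ≤ invariantsIdentityComponent A G)
    (hT : IsCompactTorus T) (x : H0 A (G ⧸ T)) :
    HomogeneousSpace.IsClosedHomogeneousSubmanifold (E := E) T
        (Subtype.val '' connectedComponent x) ∧
      ∀ y ∈ connectedComponent x, ∀ z ∈ connectedComponent x,
        coboundary T y = coboundary T z := by
  have hA : ∀ a : A, Continuous fun g : G => a • g := fun a => (hsmooth a).continuous
  have hTA : ∀ t ∈ T, ∀ a : A, a • t = t := fun t ht =>
    smul_eq_of_mem_invariantsIdentityComponent (hTH ht)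
  have _ : IsManifold 𝓘(ℝ, E) ∞ G := LieGroup.toContMDiffMul.toIsManifold
  obtain ⟨ψ, V, h1ψ, hψ1, hψs, hψt, hψV⟩ := exists_linearizing_chart hsmooth
  have hnear := mem_invariantsIdentityComponent_of_near_one h1ψ hψ1 hψV
  have hM := image_connectedComponent_H0 hA hT hTA hnear x
  set H := invariantsIdentityComponent A G with hH
  refine ⟨⟨⟨?_, ?_⟩, H, isClosed_invariantsIdentityComponent hA, x, hM⟩, ?_⟩
  · exact (isClosed_H0 hA hT.isClosed).isClosedEmbedding_subtypeVal.isClosedMap _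
      isClosed_connectedComponent
  · obtain ⟨k, s, hs, hsadd, hsT, hsinj, hsopen⟩ := hT.exists_param
    obtain ⟨O, hO, hOH⟩ := hnear
    refine ⟨Module.finrank ℝ V - k, Module.finrank ℝ E - Module.finrank ℝ V, fun y hy => ?_⟩
    have hyfix : y ∈ H0 A (G ⧸ T) := by
      obtain ⟨z, -, rfl⟩ := hy
      exact z.2
    have horb : ∀ z, z ∈ Subtype.val '' connectedComponent x ↔ ∃ l ∈ H, z = l • y := by
      rw [hM] at hy ⊢
      obtain ⟨l, hl, rfl⟩ := hy
      refine fun z => ⟨?_, ?_⟩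
      · rintro ⟨l', hl', rfl⟩
        exact ⟨l' * l⁻¹, H.mul_mem hl' (H.inv_mem hl), by rw [mul_smul, inv_smul_smul]⟩
      · rintro ⟨l', hl', rfl⟩
        exact ⟨l' * l, H.mul_mem hl' hl, (mul_smul _ _ _).symm⟩
    obtain ⟨g, rfl⟩ := QuotientGroup.mk_surjective y
    -- With `c = g⁻¹ a(g) ∈ T`, applying `a` gives `g (c t c⁻¹) g⁻¹`, and `c` commutes with `t`.
    have hconj : ∀ t ∈ T, ∀ a : A, a • (g * t * g⁻¹) = g * t * g⁻¹ := by
      intro t ht a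
      have hc := (mk_mem_H0_iff g).mp hyfix a
      have h1 : a • g = g * (g⁻¹ * a • g) := (mul_inv_cancel_left _ _).symm
      rw [smul_mul', smul_mul', smul_inv', hTA t ht, h1, mul_assoc g, hT.mul_comm hc ht]
      group
    obtain ⟨φ, hgφ, hφ, hφM⟩ := exists_slice_chart h1ψ hψ1 hψs hψt hs hsadd hsT hsinj hsopen g
      (fun u hu => (hψV _ hu).mp (hconj _ (hsT u))) hO
    refine ⟨φ, hgφ, hφ, fun z hz => ?_⟩
    obtain ⟨h, hhψ, hhO, hzh, hhV⟩ := hφM (φ z) (φ.map_source hz)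
    rw [φ.left_inv hz] at hzh
    rw [← hhV, ← hψV h hhψ, horb]
    constructor
    · rintro ⟨l, hl, hzl⟩
      have h1 : ((h * g : G) : G ⧸ T) = ((l * g : G) : G ⧸ T) := hzh.symm.trans hzl
      -- Equality of the cosets of `h g` and `l g` makes `h` the product of `l` and an element of `g
      -- T g⁻¹`, both invariant. In the converse direction, closeness to one (`hOH`) puts an
      -- invariant `h` in `H`.
      have h2 := hconj _ (T.inv_mem (QuotientGroup.eq.mp h1))
      have h3 : h = l * (g * ((h * g)⁻¹ * (l * g))⁻¹ * g⁻¹) := by group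
      intro a
      rw [h3, smul_mul', h2, smul_eq_of_mem_invariantsIdentityComponent hl]
    · intro hfix
      exact ⟨h, hOH h hhO hfix, hzh⟩
  · have hconst : ∀ y ∈ connectedComponent x, coboundary T y = coboundary T x := by
      intro y hy
      obtain ⟨l, hl, h⟩ := hM.subset (Set.mem_image_of_mem _ hy)
      exact coboundary_eq_of_smul (smul_eq_of_mem_invariantsIdentityComponent hl) h
    exact fun y hy z hz => (hconst y hy).trans (hconst z hz).symm

theorem mainTheorem12 {E G : Type*} [NormedAddCommGroup E] [NormedSpace ℝ E]
    [FiniteDimensional ℝ E] [TopologicalSpace G] [T2Space G] [ConnectedSpace G]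
    [ChartedSpace E G] [Group G] [IsTopologicalGroup G] [LieGroup 𝓘(ℝ, E) ∞ G]
    (n : ℕ) [NeZero n] [MulDistribMulAction (Multiplicative (ZMod n)) G]
    (hsmooth : ∀ a : Multiplicative (ZMod n),
      ContMDiff 𝓘(ℝ, E) 𝓘(ℝ, E) ∞ (fun g : G => a • g))
    (T : Subgroup G)
    (hT : IsMaximalCompactTorus (invariantsIdentityComponent (Multiplicative (ZMod n)) G) T) :
    haveI : NonabelianCohomology.IsSubmodule (Multiplicative (ZMod n)) T := hT.isSubmodule
    ∀ x : NonabelianCohomology.H0 (Multiplicative (ZMod n)) (G ⧸ T),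
      HomogeneousSpace.IsClosedHomogeneousSubmanifold (E := E) T
          (Subtype.val '' connectedComponent x) ∧
        ∀ y ∈ connectedComponent x, ∀ z ∈ connectedComponent x,
          NonabelianCohomology.coboundary T y = NonabelianCohomology.coboundary T z := by
  have : NonabelianCohomology.IsSubmodule (Multiplicative (ZMod n)) T := hT.isSubmodule
  exact fun x => isClosedHomogeneousSubmanifold_component_H0 hsmooth hT.prop.1 hT.prop.2 x
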